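/- **Theorem (Optimal value function error representation).** Let $U,V,H$ be real separable Hilbert spaces with $V\subset H$ compactly and densely embedded, $V\subset H\simeq H'\subset V'$, let $T>0$ and $W(0,T)=H^1(0,T;V')\cap L^2(0,T;V)$. Let $A\in L^\infty(0,T;\mathcal L(V,V'))$ satisfy $\langle A(t)v,v\rangle_{V',V}\ge\eta_V|v|_V^2$ for almost all $t\in(0,T)$ and all $v\in V$, with some $\eta_V>0$; let $C\in L^\infty(0,T;\mathcal L(H,H))$, $B\in\mathcal L(U,V')$, $\beta>0$, $y_d\in L^2(0,T;H)$, $y_0\in H$. Set $$J(y,u)=\int_0^T\tfrac12|C(t)y(t)-y_d(t)|_H^2+\tfrac\beta2|u(t)|_U^2\,dt .$$ *Full problem.* For $u\in L^2(0,T;U)$ let $y(u)\in W(0,T)$ be the solution of $\partial_ty+Ay=Bu$ in $V'$ a.e. in $(0,T)$, $y(0)=y_0$, and $\hat J(u)=J(y(u),u)$. Let $\bar u$ be the minimizer of $\hat J$ over $L^2(0,T;U)$, $\bar y=y(\bar u)$, and let $\bar p\in W(0,T)$ solve $-\partial_t\bar p+A'\bar p=C'(C\bar y-y_d)$ in $V'$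 a.e. in $(0,T)$, $\bar p(T)=0$. *Reduced problem.* Let $v_1,\dots,v_r\in V$, $V_r=\operatorname{span}(v_1,\dots,v_r)$, $U_r=\operatorname{span}(\mathcal J_U^{-1}B'v_1,\dots,\mathcal J_U^{-1}B'v_r)$, where $\mathcal J_U:U\to U'$ is the Riesz isomorphism and $B'\in\mathcal L(V,U')$ the dual operator of $B$, and let $W^r(0,T)=H^1(0,T;V_r')\cap L^2(0,T;V_r)\subset W(0,T)$. For $u\in L^2(0,T;U)$ let $y^r(u)\in W^r(0,T)$ be the solution of $\partial_ty^r+Ay^r=Bu$ in $V_r'$ a.e. in $(0,T)$, with $y^r(0)$ the $H$-orthogonal projection of $y_0$ onto $V_r$, and $\hat J^r(u)=J(y^r(u),u)$. Let $\bar u^r$ be the minimizer of $\hat J^r$ over $L^2(0,T;U_r)$, $\bar y^r=y^r(\bar u^r)$, and let $\bar p^r\in W^r(0,T)$ solve $-\partial_t\bar p^r+A'\bar p^r=C'(C\bar y^r-y_d)$ in $V_r'$ a.e. in $(0,T)$, $\bar p^r(T)=0$. Put $\bar x^r=(\bar y^r,\bar u^r,\bar p^r)$. *Lagrangian.* For $x=(y,u,p)\in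 W(0,T)\times L^2(0,T;U)\times W(0,T)$ let $$L(x)=\tfrac12\|Cy-y_d\|_{L^2(0,T;H)}^2+\tfrac\beta2\|u\|_{L^2(0,T;U)}^2+\langle Bu-\partial_ty-Ay,\,p\rangle_{L^2(0,T;V'),L^2(0,T;V)}+\langle y_0-y(0),p(0)\rangle_H .$$ Then $L$ has partial Fréchet derivatives $L'_y(\bar x^r)$ and $L'_p(\bar x^r)$ with respect to $y$ and $p$ at $\bar x^r$, the infimum below is finite, and $$\hat J(\bar u)-\hat J^r(\bar u^r)=\tfrac12\inf\big\{L'_y(\bar x^r)(\bar y-y^r)+L'_p(\bar x^r)(\bar p-p^r)\;\big|\;y^r,p^r\in W^r(0,T)\big\}.$$ In particular, no term $L'_u(\bar x^r)$ stemming from the reduction of the control space appears. -/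

import Mathlib

open MeasureTheory Set Filter Topology
open scoped ENNReal InnerProductSpace ContDiff

noncomputable section

namespace ParabolicOCP

/-- Lebesgue measure on the time interval `(0,T)`. -/
abbrev timeMeasure (T : ℝ) : Measure ℝ := volume.restrict (Ioo 0 T)

section Spaces

variable {V H U : Type*}
  [NormedAddCommGroup V] [InnerProductSpace ℝ V]
  [NormedAddCommGroup H] [InnerProductSpace ℝ H]
  [NormedAddCommGroup U] [InnerProductSpace ℝ U]

/-- The embedding `V ⊂ H ≃ H' ⊂ V'` belonging to `ι : V → H`, i.e. `v ↦ (w ↦ ⟪ι v, ι w⟫_H)`. -/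
def toDualOf (ι : V →L[ℝ] H) : V →L[ℝ] StrongDual ℝ V :=
  (innerSL ℝ).bilinearComp ι ι

/-- `g : (0,T) → V'` is the weak (distributional) time derivative of `y : (0,T) → V ⊂ V'`. -/
def IsWeakTimeDeriv (T : ℝ) (ι : V →L[ℝ] H) (y : ℝ → V) (g : ℝ → StrongDual ℝ V) : Prop :=
  ∀ φ : ℝ → ℝ, ContDiff ℝ ∞ φ → HasCompactSupport φ → tsupport φ ⊆ Ioo 0 T →
    ∫ t, deriv φ t • toDualOf ι (y t) ∂timeMeasure T = - ∫ t, φ t • g t ∂timeMeasure T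

theorem integrable_test_smul {E : Type*} [NormedAddCommGroup E] [NormedSpace ℝ E] {T : ℝ}
    {ψ : ℝ → ℝ} (hψ : Continuous ψ) (hc : HasCompactSupport ψ) {f : ℝ → E}
    (hf : MemLp f 2 (timeMeasure T)) :
    Integrable (fun t => ψ t • f t) (timeMeasure T) := by
  obtain ⟨K, hK⟩ := hc.exists_bound_of_continuous hψ
  exact (hf.integrable (by norm_num)).bdd_smul K hψ.aestronglyMeasurable
    (Eventually.of_forall hK)

theorem memLp_toDualOf {T : ℝ} (ι : V →L[ℝ] H) {y : ℝ → V} (hy : MemLp y 2 (timeMeasure T)) :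
    MemLp (fun t => toDualOf ι (y t)) 2 (timeMeasure T) :=
  (toDualOf ι).comp_memLp' hy

/-- The state space `W(0,T) = H¹(0,T;V') ∩ L²(0,T;V)`. An element is the pair `(y, ∂ₜy)` in
`L²(0,T;V) × L²(0,T;V')`, and the norm is `max (‖y‖, ‖∂ₜy‖)`, which is equivalent to the usual
Hilbert norm. -/
def stateSpace (T : ℝ) (ι : V →L[ℝ] H) :
    Submodule ℝ (Lp V 2 (timeMeasure T) × Lp (StrongDual ℝ V) 2 (timeMeasure T)) where
  carrier := {x | IsWeakTimeDeriv T ι x.1 x.2}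
  zero_mem' := by
    intro φ _ _ _
    have h1 : ∫ t, deriv φ t • toDualOf ι
        ((0 : Lp V 2 (timeMeasure T)) t) ∂timeMeasure T = 0 := by
      apply integral_eq_zero_of_ae
      filter_upwards [Lp.coeFn_zero V 2 (timeMeasure T)] with t ht
      rw [ht]
      simp
    have h2 : ∫ t, φ t •
        ((0 : Lp (StrongDual ℝ V) 2 (timeMeasure T)) t) ∂timeMeasure T = 0 := by
      apply integral_eq_zero_of_ae
      filter_upwards [Lp.coeFn_zero (StrongDual ℝ V) 2 (timeMeasure T)] with t ht
      rw [ht]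
      simp
    rw [Prod.fst_zero, Prod.snd_zero, h1, h2, neg_zero]
  add_mem' := by
    intro a b ha hb φ hφ hc hs
    have hd : Continuous (deriv φ) := hφ.continuous_deriv (by norm_num)
    have h1 : ∫ t, deriv φ t • toDualOf ι ((a.1 + b.1 : Lp V 2 (timeMeasure T)) t) ∂timeMeasure T
        = ∫ t, (deriv φ t • toDualOf ι (a.1 t) + deriv φ t • toDualOf ι (b.1 t))
          ∂timeMeasure T := by
      apply integral_congr_ae
      filter_upwards [Lp.coeFn_add a.1 b.1] with t ht
      rw [ht, Pi.add_apply, map_add, smul_add]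
    have h2 : ∫ t, φ t • ((a.2 + b.2 : Lp (StrongDual ℝ V) 2 (timeMeasure T)) t) ∂timeMeasure T
        = ∫ t, (φ t • a.2 t + φ t • b.2 t) ∂timeMeasure T := by
      apply integral_congr_ae
      filter_upwards [Lp.coeFn_add a.2 b.2] with t ht
      rw [ht, Pi.add_apply, smul_add]
    rw [Prod.fst_add, Prod.snd_add, h1, h2,
      integral_add (integrable_test_smul hd hc.deriv (memLp_toDualOf ι (Lp.memLp a.1)))
        (integrable_test_smul hd hc.deriv (memLp_toDualOf ι (Lp.memLp b.1))),
      integral_add (integrable_test_smul hφ.continuous hc (Lp.memLp a.2))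
        (integrable_test_smul hφ.continuous hc (Lp.memLp b.2)),
      ha φ hφ hc hs, hb φ hφ hc hs, neg_add]
  smul_mem' := by
    intro k a ha φ hφ hc hs
    have h1 : ∫ t, deriv φ t • toDualOf ι ((k • a.1 : Lp V 2 (timeMeasure T)) t) ∂timeMeasure T
        = ∫ t, k • (deriv φ t • toDualOf ι (a.1 t)) ∂timeMeasure T := by
      apply integral_congr_ae
      filter_upwards [Lp.coeFn_smul k a.1] with t ht
      rw [ht, Pi.smul_apply, map_smul, smul_comm]
    have h2 : ∫ t, φ t • ((k • a.2 : Lp (StrongDual ℝ V) 2 (timeMeasure T)) t) ∂timeMeasure T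
        = ∫ t, k • (φ t • a.2 t) ∂timeMeasure T := by
      apply integral_congr_ae
      filter_upwards [Lp.coeFn_smul k a.2] with t ht
      rw [ht, Pi.smul_apply, smul_comm]
    rw [Prod.smul_fst, Prod.smul_snd, h1, h2, integral_smul, integral_smul, ha φ hφ hc hs, smul_neg]

variable {T : ℝ} {ι : V →L[ℝ] H}

/-- The value `y(t) ∈ V` (defined for almost every `t`). -/
def val (y : stateSpace T ι) (t : ℝ) : V := y.1.1 t

/-- The value `∂ₜy(t) ∈ V'` of the weak time derivative (defined for almost every `t`). -/
def timeDeriv (y : stateSpace T ι) (t : ℝ) : StrongDual ℝ V := y.1.2 t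

/-- `c` is the representative of `y` in `C([0,T];H)`. -/
def IsContinuousRep (y : stateSpace T ι) (c : ℝ → H) : Prop :=
  ContinuousOn c (Icc 0 T) ∧ ∀ᵐ t ∂timeMeasure T, c t = ι (val y t)

open Classical in
/-- The point value `y(t) ∈ H`, `t ∈ [0,T]`, of `y ∈ W(0,T)`: the value at `t` of the
representative of `y` in `C([0,T];H)`, which exists for every `y ∈ W(0,T)` if `ι` is an injection
with dense range (and is unique on `[0,T]` if `0 < T`). -/
def pointValue (y : stateSpace T ι) (t : ℝ) : H :=
  if h : ∃ c, IsContinuousRep y c then h.choose t else 0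

/-- The reduced state space `Wʳ(0,T) = H¹(0,T;Vᵣ') ∩ L²(0,T;Vᵣ)`, `Vᵣ ⊂ V` finite-dimensional.
All norms on `Vᵣ` are equivalent and `Vᵣ' = Vᵣ` through the inner product of `H`, so these are
exactly the elements of `W(0,T)` with values in `Vᵣ`, and the derivative in `Vᵣ'` is the
restriction to `Vᵣ` of the derivative in `V'`. -/
def IsReducedState (Vr : Submodule ℝ V) (y : stateSpace T ι) : Prop :=
  ∀ᵐ t ∂timeMeasure T, val y t ∈ Vr

end Spaces

section Problem

variable {V H U : Type*}
  [NormedAddCommGroup V] [InnerProductSpace ℝ V]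
  [NormedAddCommGroup H] [InnerProductSpace ℝ H]
  [NormedAddCommGroup U] [InnerProductSpace ℝ U]

/-- The data of the linear-quadratic parabolic optimal control problem: `A ∈ L^∞(0,T;L(V,V'))`
coercive uniformly in time, `C ∈ L^∞(0,T;L(H,H))`, `B ∈ L(U,V')`, `β > 0`, `y_d ∈ L²(0,T;H)`,
`y₀ ∈ H`. -/
structure Data (T : ℝ) (V H U : Type*)
    [NormedAddCommGroup V] [InnerProductSpace ℝ V]
    [NormedAddCommGroup H] [InnerProductSpace ℝ H]
    [NormedAddCommGroup U] [InnerProductSpace ℝ U] where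
  A : ℝ → V →L[ℝ] StrongDual ℝ V
  C : ℝ → H →L[ℝ] H
  B : U →L[ℝ] StrongDual ℝ V
  β : ℝ
  yd : Lp H 2 (timeMeasure T)
  y0 : H
  A_memLp : MemLp A ∞ (timeMeasure T)
  A_coercive : ∃ η : ℝ, 0 < η ∧ ∀ᵐ t ∂timeMeasure T, ∀ v : V, η * ‖v‖ ^ 2 ≤ A t v v
  C_memLp : MemLp C ∞ (timeMeasure T)
  β_pos : 0 < β

variable {T : ℝ} {ι : V →L[ℝ] H}

/-- The cost `J(y,u) = ∫₀ᵀ ½ ‖C(t) y(t) - y_d(t)‖_H² + β/2 ‖u(t)‖_U² dt`. -/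
def cost (D : Data T V H U) (y : stateSpace T ι) (u : Lp U 2 (timeMeasure T)) : ℝ :=
  ∫ t, (1 / 2 * ‖D.C t (ι (val y t)) - D.yd t‖ ^ 2 + D.β / 2 * ‖u t‖ ^ 2) ∂timeMeasure T

/-- `y = y(u)`: `y ∈ W(0,T)`, `∂ₜy + A y = B u` in `V'` a.e. in `(0,T)`, and `y(0) = y₀` in `H`. -/
def IsState (D : Data T V H U) (u : Lp U 2 (timeMeasure T)) (y : stateSpace T ι) : Prop :=
  (∀ᵐ t ∂timeMeasure T, timeDeriv y t + D.A t (val y t) = D.B (u t)) ∧ pointValue y 0 = D.y0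

/-- `p = p(y)`: `p ∈ W(0,T)`, `-∂ₜp + A' p = C'(C y - y_d)` in `V'` a.e. in `(0,T)`, and
`p(T) = 0` in `H`. -/
def IsAdjoint (D : Data T V H U) (y p : stateSpace T ι) : Prop :=
  (∀ᵐ t ∂timeMeasure T, ∀ w : V,
    - timeDeriv p t w + D.A t w (val p t)
      = ⟪D.C t (ι (val y t)) - D.yd t, D.C t (ι w)⟫_ℝ) ∧
  pointValue p T = 0

/-- `u` is an optimal control and `y = y(u)` the associated optimal state of the full problem: the
pair minimizes `J` over all pairs in `W(0,T) × L²(0,T;U)` that solve the state equation. -/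
def IsOptimal (D : Data T V H U) (u : Lp U 2 (timeMeasure T)) (y : stateSpace T ι) : Prop :=
  IsState D u y ∧
    ∀ (u' : Lp U 2 (timeMeasure T)) (y' : stateSpace T ι), IsState D u' y' →
      cost D y u ≤ cost D y' u'

/-- The reduced space `Vᵣ = span(v₁,…,vᵣ) ⊂ V`. -/
def redSpace {r : ℕ} (v : Fin r → V) : Submodule ℝ V := Submodule.span ℝ (range v)

/-- `Vᵣ` as a subspace of `H`. -/
def redSpaceH (ι : V →L[ℝ] H) {r : ℕ} (v : Fin r → V) : Submodule ℝ H :=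
  (redSpace v).map (ι : V →ₗ[ℝ] H)

instance {r : ℕ} (v : Fin r → V) : FiniteDimensional ℝ (redSpace v) :=
  FiniteDimensional.span_of_finite ℝ (finite_range v)

instance {r : ℕ} (v : Fin r → V) : FiniteDimensional ℝ (redSpaceH ι v) :=
  inferInstanceAs (FiniteDimensional ℝ ((redSpace v).map (ι : V →ₗ[ℝ] H)))

/-- The reduced control space `Uᵣ = span(u₁,…,uᵣ) ⊂ U`, where `uᵢ = 𝒥_U⁻¹ B' vᵢ`, with
`B' ∈ L(V,U')` the dual operator of `B` and `𝒥_U : U → U'` the Riesz isomorphism. -/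
def redControlSpace [CompleteSpace U] (D : Data T V H U) {r : ℕ} (v : Fin r → V) :
    Submodule ℝ U :=
  Submodule.span ℝ (range fun i => (InnerProductSpace.toDual ℝ U).symm (D.B.flip (v i)))

/-- `y = yʳ(u)`: `y ∈ Wʳ(0,T)`, `∂ₜy + A y = B u` in `Vᵣ'` a.e. in `(0,T)`, and `y(0)` is the
`H`-orthogonal projection of `y₀` onto `Vᵣ`. -/
def IsRedState (D : Data T V H U) {r : ℕ} (v : Fin r → V)
    (u : Lp U 2 (timeMeasure T)) (y : stateSpace T ι) : Prop :=
  IsReducedState (redSpace v) y ∧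
  (∀ᵐ t ∂timeMeasure T, ∀ w ∈ redSpace v,
    timeDeriv y t w + D.A t (val y t) w = D.B (u t) w) ∧
  pointValue y 0 = (redSpaceH ι v).starProjection D.y0

/-- `p = pʳ(y)`: `p ∈ Wʳ(0,T)`, `-∂ₜp + A' p = C'(C y - y_d)` in `Vᵣ'` a.e. in `(0,T)`, and
`p(T) = 0` in `H`. -/
def IsRedAdjoint (D : Data T V H U) {r : ℕ} (v : Fin r → V) (y p : stateSpace T ι) : Prop :=
  IsReducedState (redSpace v) p ∧
  (∀ᵐ t ∂timeMeasure T, ∀ w ∈ redSpace v,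
    - timeDeriv p t w + D.A t w (val p t)
      = ⟪D.C t (ι (val y t)) - D.yd t, D.C t (ι w)⟫_ℝ) ∧
  pointValue p T = 0

/-- `u` is an optimal control and `y = yʳ(u)` the associated optimal state of the control- and
state-reduced problem: `u ∈ L²(0,T;Uᵣ)` minimizes `Ĵʳ(u) = J(yʳ(u),u)` over `L²(0,T;Uᵣ)`. -/
def IsRedOptimal [CompleteSpace U] (D : Data T V H U) {r : ℕ} (v : Fin r → V)
    (u : Lp U 2 (timeMeasure T)) (y : stateSpace T ι) : Prop :=
  (∀ᵐ t ∂timeMeasure T, u t ∈ redControlSpace D v) ∧ IsRedState D v u y ∧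
    ∀ (u' : Lp U 2 (timeMeasure T)) (y' : stateSpace T ι),
      (∀ᵐ t ∂timeMeasure T, u' t ∈ redControlSpace D v) → IsRedState D v u' y' →
        cost D y u ≤ cost D y' u'

/-- The Lagrange function on `W(0,T) × L²(0,T;U) × W(0,T)`:
`L(y,u,p) = ½ ‖C y - y_d‖² + β/2 ‖u‖² + ⟨B u - ∂ₜy - A y, p⟩_{L²(V'),L²(V)} + ⟪y₀ - y(0), p(0)⟫_H`,
with multiplier `p` for the state equation and `p(0)` for the initial condition. -/
def lagrangian (D : Data T V H U) (y : stateSpace T ι) (u : Lp U 2 (timeMeasure T))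
    (p : stateSpace T ι) : ℝ :=
  1 / 2 * (∫ t, ‖D.C t (ι (val y t)) - D.yd t‖ ^ 2 ∂timeMeasure T)
    + D.β / 2 * ‖u‖ ^ 2
    + (∫ t, (D.B (u t) - timeDeriv y t - D.A t (val y t)) (val p t) ∂timeMeasure T)
    + ⟪D.y0 - pointValue y 0, pointValue p 0⟫_ℝ

/-- The partial Fréchet derivative `L'_y(y,u,p)`. -/
def lagrangianDerivY (D : Data T V H U) (y : stateSpace T ι) (u : Lp U 2 (timeMeasure T))
    (p : stateSpace T ι) : stateSpace T ι →L[ℝ] ℝ :=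
  fderiv ℝ (fun z => lagrangian D z u p) y

/-- The partial Fréchet derivative `L'_p(y,u,p)`. -/
def lagrangianDerivP (D : Data T V H U) (y : stateSpace T ι) (u : Lp U 2 (timeMeasure T))
    (p : stateSpace T ι) : stateSpace T ι →L[ℝ] ℝ :=
  fderiv ℝ (fun q => lagrangian D y u q) p

/-- The set of all values `L'_y(x)(ȳ - yʳ) + L'_p(x)(p̄ - pʳ)` with `yʳ, pʳ ∈ Wʳ(0,T)`, at the
point `x = (y,u,p)`. -/
def errorTerms (D : Data T V H U) {r : ℕ} (v : Fin r → V) (y : stateSpace T ι)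
    (u : Lp U 2 (timeMeasure T)) (p : stateSpace T ι) (ybar pbar : stateSpace T ι) : Set ℝ :=
  {s | ∃ z q : stateSpace T ι,
    IsReducedState (redSpace v) z ∧ IsReducedState (redSpace v) q ∧
    s = lagrangianDerivY D y u p (ybar - z) + lagrangianDerivP D y u p (pbar - q)}

end Problem

end ParabolicOCP

end

open MeasureTheory Set Filter Topology
open scoped ENNReal InnerProductSpace ContDiff

noncomputable section

namespace ParabolicOCP

/-! ### Absolutely continuous primitives with values in a Banach space. -/

section AbsolutelyContinuous

variable {X E F G : Type*} [PseudoMetricSpace X]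
  [NormedAddCommGroup E] [NormedSpace ℝ E] [NormedAddCommGroup F] [NormedSpace ℝ F]
  [NormedAddCommGroup G] [NormedSpace ℝ G]

/-! At the reduced solution, `L'_y` vanishes on reduced functions by the reduced adjoint equation,
and `L'_p` vanishes on them by the reduced state equation together with the orthogonality of `y₀ -
yʳ(0)` to `Vᵣ`. Hence the set under the infimum is a singleton (`errorTerms_eq_singleton`), and the
claim becomes an identity between the two costs (`cost_sub_cost_eq`).

That identity uses the gradient condition `β u + 𝒥_U⁻¹ B' p = 0` in both problems. In the reduced
problem only variations in `L²(0,T;Uᵣ)` are admissible. But the adjoint takes values in `Vᵣ` and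
`𝒥_U⁻¹ B'` maps `Vᵣ` into `Uᵣ`, so the gradient is itself an admissible direction; testing with it
gives norm zero. This is why no term `L'_u` survives. With both gradient conditions, the quadratic
tracking term expands into pairings that the two adjoint equations evaluate, and all control terms
cancel.

Two analytic facts about `W(0,T)` are needed. The first is the embedding into `C([0,T];H)` with
integration by parts (`inner_pointValue_sub`). With `K = ι* ι`, the function `K y` is a primitive in
`V` of the Riesz representative of `∂ₜy`; applying the resolvents `(K + 1/(n+1))⁻¹` gives
approximations for which the product rule holds classically, and these converge uniformly in `H`.
The second is solvability of the state equation with zero initial value, which supplies the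
variations of the state. It follows from Lions' projection lemma (`exists_solution`); the reduced
version is the same theorem on the finite-dimensional space, lifted back to `W(0,T)`
(`exists_reduced_solution`). -/

theorem absolutelyContinuousOnInterval_of_dist_le {h : ℝ → X} {Φ : ℝ → ℝ} {a b : ℝ}
    (hΦ : AbsolutelyContinuousOnInterval Φ a b)
    (hd : ∀ s ∈ uIcc a b, ∀ t ∈ uIcc a b, dist (h s) (h t) ≤ dist (Φ s) (Φ t)) :
    AbsolutelyContinuousOnInterval h a b := by
  rw [absolutelyContinuousOnInterval_iff] at hΦ ⊢
  intro ε hε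
  obtain ⟨δ, hδ, H⟩ := hΦ ε hε
  refine ⟨δ, hδ, fun I hI hlt => lt_of_le_of_lt (Finset.sum_le_sum fun i hi => ?_) (H I hI hlt)⟩
  have := hI.1 i hi
  exact hd _ this.1 _ this.2

theorem intervalIntegrable_of_mem_uIcc {E : Type*} [NormedAddCommGroup E] {f : ℝ → E} {a b s t : ℝ}
    (hf : IntervalIntegrable f volume a b) (hs : s ∈ uIcc a b) (ht : t ∈ uIcc a b) :
    IntervalIntegrable f volume s t :=
  hf.mono_set (uIcc_subset_uIcc hs ht)

theorem dist_integral_le {f : ℝ → E} {g : ℝ → ℝ} {a b : ℝ}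
    (hf : IntervalIntegrable f volume a b) (hg : IntervalIntegrable g volume a b)
    (hfg : ∀ x, ‖f x‖ ≤ g x) {s t : ℝ} (hs : s ∈ uIcc a b) (ht : t ∈ uIcc a b) :
    dist (∫ x in a..s, f x) (∫ x in a..t, f x) ≤
      dist (∫ x in a..s, g x) (∫ x in a..t, g x) := by
  have h1 := intervalIntegrable_of_mem_uIcc hf left_mem_uIcc hs
  have h2 := intervalIntegrable_of_mem_uIcc hf left_mem_uIcc ht
  have h3 := intervalIntegrable_of_mem_uIcc hg left_mem_uIcc hs
  have h4 := intervalIntegrable_of_mem_uIcc hg left_mem_uIcc ht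
  rw [dist_eq_norm, dist_eq_norm, intervalIntegral.integral_interval_sub_left h1 h2,
    intervalIntegral.integral_interval_sub_left h3 h4, Real.norm_eq_abs]
  exact intervalIntegral.norm_integral_le_abs_of_norm_le (.of_forall fun x => hfg x)
    (intervalIntegrable_of_mem_uIcc hg ht hs)

theorem absolutelyContinuousOnInterval_integral {f : ℝ → E} {a b : ℝ}
    (hf : IntervalIntegrable f volume a b) :
    AbsolutelyContinuousOnInterval (fun x => ∫ y in a..x, f y) a b :=
  absolutelyContinuousOnInterval_of_dist_le
    (hf.norm.absolutelyContinuousOnInterval_intervalIntegral left_mem_uIcc)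
    fun _ hs _ ht => dist_integral_le hf hf.norm (fun _ => le_rfl) hs ht

/-- The difference of `h` and the primitive of `h'` is absolutely continuous with derivative zero
almost everywhere, hence constant. -/
theorem integral_eq_sub_of_absolutelyContinuous [CompleteSpace G] {h h' : ℝ → G} {a b : ℝ}
    (hh : AbsolutelyContinuousOnInterval h a b) (hi : IntervalIntegrable h' volume a b)
    (hd : ∀ᵐ x, x ∈ uIcc a b → HasDerivAt h (h' x) x) :
    ∫ x in a..b, h' x = h b - h a := by
  have hac := hh.sub (absolutelyContinuousOnInterval_integral hi)
  obtain ⟨C, hC⟩ := hac.const_of_ae_hasDerivAt_zero (by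
    filter_upwards [hd, hi.ae_hasDerivAt_integral] with x h1 h2 hx
    simpa using (h1 hx).sub (h2 hx a left_mem_uIcc))
  have ha := hC a left_mem_uIcc
  have hb := hC b right_mem_uIcc
  simp only [Pi.sub_apply, intervalIntegral.integral_same, sub_zero] at ha hb
  rw [ha, ← hb]
  abel

/-- `Y` is a primitive of the integrable function `f` on the interval from `a` to `b`. -/
structure IsPrimitiveOn (Y f : ℝ → E) (a b : ℝ) : Prop where
  integrable : IntervalIntegrable f volume a b
  eq_add : ∀ x ∈ uIcc a b, Y x = Y a + ∫ y in a..x, f y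

namespace IsPrimitiveOn

variable {Y f : ℝ → E} {Z g : ℝ → F} {a b : ℝ}

theorem mono (h : IsPrimitiveOn Y f a b) {s t : ℝ} (hs : s ∈ uIcc a b) (ht : t ∈ uIcc a b) :
    IsPrimitiveOn Y f s t where
  integrable := intervalIntegrable_of_mem_uIcc h.integrable hs ht
  eq_add x hx := by
    have hx' := uIcc_subset_uIcc hs ht hx
    rw [h.eq_add x hx', h.eq_add s hs, add_assoc,
      intervalIntegral.integral_add_adjacent_intervals
        (intervalIntegrable_of_mem_uIcc h.integrable left_mem_uIcc hs)
        (intervalIntegrable_of_mem_uIcc h.integrable hs hx')]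

theorem comp_clm [CompleteSpace E] [CompleteSpace F] (h : IsPrimitiveOn Y f a b) (S : E →L[ℝ] F) :
    IsPrimitiveOn (fun x => S (Y x)) (fun x => S (f x)) a b where
  integrable := ⟨S.integrable_comp h.integrable.1, S.integrable_comp h.integrable.2⟩
  eq_add x hx := by
    rw [h.eq_add x hx, map_add, S.intervalIntegral_comp_comm
      (intervalIntegrable_of_mem_uIcc h.integrable left_mem_uIcc hx)]

theorem absolutelyContinuous (h : IsPrimitiveOn Y f a b) :
    AbsolutelyContinuousOnInterval Y a b := by
  refine absolutelyContinuousOnInterval_of_dist_le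
    (h.integrable.norm.absolutelyContinuousOnInterval_intervalIntegral left_mem_uIcc)
    fun s hs t ht => ?_
  rw [h.eq_add s hs, h.eq_add t ht, dist_add_left]
  exact dist_integral_le h.integrable h.integrable.norm (fun _ => le_rfl) hs ht

theorem continuousOn (h : IsPrimitiveOn Y f a b) : ContinuousOn Y (uIcc a b) :=
  h.absolutelyContinuous.continuousOn

theorem ae_hasDerivAt [CompleteSpace E] (h : IsPrimitiveOn Y f a b) :
    ∀ᵐ x, x ∈ uIcc a b → HasDerivAt Y (f x) x := by
  -- The formula for `Y` is known only on the interval, so a two-sided derivative is available only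
  -- at interior points; the endpoints are null.
  have ha : ∀ᵐ x : ℝ, x ≠ a := by simp [ae_iff, measure_singleton]
  have hb : ∀ᵐ x : ℝ, x ≠ b := by simp [ae_iff, measure_singleton]
  filter_upwards [h.integrable.ae_hasDerivAt_integral, ha, hb] with x hx hxa hxb hm
  have h1 := (hx hm a left_mem_uIcc).const_add (Y a)
  refine h1.congr_of_eventuallyEq ?_
  have hn : uIcc a b ∈ 𝓝 x := by
    rw [uIcc, Icc_mem_nhds_iff]
    rcases mem_uIcc.1 hm with ⟨h2, h3⟩ | ⟨h2, h3⟩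
    · have h4 := lt_of_le_of_ne h2 hxa.symm
      have h5 := lt_of_le_of_ne h3 hxb
      simp [h4, h5]
    · have h4 := lt_of_le_of_ne h2 hxb.symm
      have h5 := lt_of_le_of_ne h3 hxa
      simp [h4, h5]
  filter_upwards [hn] with z hz using h.eq_add z hz

/-- Integration by parts for a continuous bilinear map and two primitives. -/
theorem integral_bilin [CompleteSpace E] [CompleteSpace F] [CompleteSpace G]
    (hY : IsPrimitiveOn Y f a b) (hZ : IsPrimitiveOn Z g a b) (B : E →L[ℝ] F →L[ℝ] G) :
    ∫ x in a..b, (B (f x) (Z x) + B (Y x) (g x)) = B (Y b) (Z b) - B (Y a) (Z a) := by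
  obtain ⟨M, hM⟩ := hY.absolutelyContinuous.exists_bound
  obtain ⟨N, hN⟩ := hZ.absolutelyContinuous.exists_bound
  have hM0 : 0 ≤ M := (norm_nonneg _).trans (hM a left_mem_uIcc)
  have hN0 : 0 ≤ N := (norm_nonneg _).trans (hN a left_mem_uIcc)
  -- This real function dominates the derivative of `B (Y x) (Z x)`; its primitive controls the
  -- increments of the product.
  have hint : IntervalIntegrable (fun x => ‖B‖ * N * ‖f x‖ + ‖B‖ * M * ‖g x‖) volume a b :=
    (hY.integrable.norm.const_mul _).add (hZ.integrable.norm.const_mul _)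
  refine integral_eq_sub_of_absolutelyContinuous (h := fun x => B (Y x) (Z x)) ?_ ?_ ?_
  · refine absolutelyContinuousOnInterval_of_dist_le
      (hint.absolutelyContinuousOnInterval_intervalIntegral left_mem_uIcc) fun s hs t ht => ?_
    have e1 : Y s - Y t = ∫ x in t..s, f x := by
      rw [hY.eq_add s hs, hY.eq_add t ht, add_sub_add_left_eq_sub,
        intervalIntegral.integral_interval_sub_left
          (intervalIntegrable_of_mem_uIcc hY.integrable left_mem_uIcc hs)
          (intervalIntegrable_of_mem_uIcc hY.integrable left_mem_uIcc ht)]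
    have e2 : Z s - Z t = ∫ x in t..s, g x := by
      rw [hZ.eq_add s hs, hZ.eq_add t ht, add_sub_add_left_eq_sub,
        intervalIntegral.integral_interval_sub_left
          (intervalIntegrable_of_mem_uIcc hZ.integrable left_mem_uIcc hs)
          (intervalIntegrable_of_mem_uIcc hZ.integrable left_mem_uIcc ht)]
    have e3 : B (Y s) (Z s) - B (Y t) (Z t) = B (Y s - Y t) (Z s) + B (Y t) (Z s - Z t) := by
      simp
    have i1 := (intervalIntegrable_of_mem_uIcc hY.integrable ht hs).norm
    have i2 := (intervalIntegrable_of_mem_uIcc hZ.integrable ht hs).norm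
    rw [dist_eq_norm, e3, dist_eq_norm, intervalIntegral.integral_interval_sub_left
      (intervalIntegrable_of_mem_uIcc hint left_mem_uIcc hs)
      (intervalIntegrable_of_mem_uIcc hint left_mem_uIcc ht),
      intervalIntegral.integral_add (i1.const_mul _) (i2.const_mul _),
      intervalIntegral.integral_const_mul, intervalIntegral.integral_const_mul, Real.norm_eq_abs]
    have n1 : ‖Y s - Y t‖ ≤ |∫ x in t..s, ‖f x‖| := by
      rw [e1]; exact intervalIntegral.norm_integral_le_abs_integral_norm
    have n2 : ‖Z s - Z t‖ ≤ |∫ x in t..s, ‖g x‖| := by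
      rw [e2]; exact intervalIntegral.norm_integral_le_abs_integral_norm
    -- Both integrals have the sign of `s - t`, so the absolute value is additive here.
    have habs : |‖B‖ * N * (∫ x in t..s, ‖f x‖) + ‖B‖ * M * ∫ x in t..s, ‖g x‖|
        = ‖B‖ * N * |∫ x in t..s, ‖f x‖| + ‖B‖ * M * |∫ x in t..s, ‖g x‖| := by
      have p1 : 0 ≤ ‖B‖ * N := by positivity
      have p2 : 0 ≤ ‖B‖ * M := by positivity
      rcases le_total t s with hts | hts
      · have q1 : 0 ≤ ∫ x in t..s, ‖f x‖ :=
          intervalIntegral.integral_nonneg hts fun _ _ => norm_nonneg _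
        have q2 : 0 ≤ ∫ x in t..s, ‖g x‖ :=
          intervalIntegral.integral_nonneg hts fun _ _ => norm_nonneg _
        rw [abs_of_nonneg q1, abs_of_nonneg q2, abs_of_nonneg (by positivity)]
      · have q1 : ∫ x in t..s, ‖f x‖ ≤ 0 := by
          rw [intervalIntegral.integral_symm, neg_nonpos]
          exact intervalIntegral.integral_nonneg hts fun _ _ => norm_nonneg _
        have q2 : ∫ x in t..s, ‖g x‖ ≤ 0 := by
          rw [intervalIntegral.integral_symm, neg_nonpos]
          exact intervalIntegral.integral_nonneg hts fun _ _ => norm_nonneg _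
        rw [abs_of_nonpos q1, abs_of_nonpos q2, abs_of_nonpos
          (add_nonpos (mul_nonpos_of_nonneg_of_nonpos p1 q1)
            (mul_nonpos_of_nonneg_of_nonpos p2 q2))]
        ring
    rw [habs]
    refine (norm_add_le _ _).trans (add_le_add ?_ ?_)
    · calc ‖B (Y s - Y t) (Z s)‖ ≤ ‖B‖ * ‖Y s - Y t‖ * ‖Z s‖ := B.le_opNorm₂ _ _
        _ ≤ ‖B‖ * |∫ x in t..s, ‖f x‖| * N := by gcongr; exact hN s hs
        _ = _ := by ring
    · calc ‖B (Y t) (Z s - Z t)‖ ≤ ‖B‖ * ‖Y t‖ * ‖Z s - Z t‖ := B.le_opNorm₂ _ _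
        _ ≤ ‖B‖ * M * |∫ x in t..s, ‖g x‖| := by gcongr; exact hM t ht
  · have hYm : AEStronglyMeasurable Y (volume.restrict (uIoc a b)) :=
      (hY.continuousOn.mono uIoc_subset_uIcc).aestronglyMeasurable measurableSet_uIoc
    have hZm : AEStronglyMeasurable Z (volume.restrict (uIoc a b)) :=
      (hZ.continuousOn.mono uIoc_subset_uIcc).aestronglyMeasurable measurableSet_uIoc
    refine hint.mono_fun ?_ ?_
    · exact (B.aestronglyMeasurable_comp₂ hY.integrable.aestronglyMeasurable_restrict_uIoc hZm).add
        (B.aestronglyMeasurable_comp₂ hYm hZ.integrable.aestronglyMeasurable_restrict_uIoc)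
    · filter_upwards [ae_restrict_mem measurableSet_uIoc] with x hx
      have hx' := uIoc_subset_uIcc hx
      rw [Real.norm_of_nonneg (by positivity)]
      refine (norm_add_le _ _).trans (add_le_add ?_ ?_)
      · calc ‖B (f x) (Z x)‖ ≤ ‖B‖ * ‖f x‖ * ‖Z x‖ := B.le_opNorm₂ _ _
          _ ≤ ‖B‖ * ‖f x‖ * N := by gcongr; exact hN x hx'
          _ = _ := by ring
      · calc ‖B (Y x) (g x)‖ ≤ ‖B‖ * ‖Y x‖ * ‖g x‖ := B.le_opNorm₂ _ _
          _ ≤ ‖B‖ * M * ‖g x‖ := by gcongr; exact hM x hx'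
  · filter_upwards [hY.ae_hasDerivAt, hZ.ae_hasDerivAt] with x h1 h2 hx
    have := B.hasFDerivAt_of_bilinear (h1 hx).hasFDerivAt (h2 hx).hasFDerivAt
    simpa [add_comm] using this.hasDerivAt

end IsPrimitiveOn

end AbsolutelyContinuous

/-! ### Weak time derivatives and the lemma of du Bois-Reymond. -/

section WeakDerivative

variable {E : Type*} [NormedAddCommGroup E] [NormedSpace ℝ E]

theorem intervalIntegrable_of_timeMeasure {E : Type*} [NormedAddCommGroup E] {T : ℝ}
    (hT : 0 < T) {f : ℝ → E}
    (hf : Integrable f (timeMeasure T)) : IntervalIntegrable f volume 0 T := by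
  rw [intervalIntegrable_iff_integrableOn_Ioo_of_le hT.le]
  exact hf

theorem integral_timeMeasure {T : ℝ} (hT : 0 < T) (f : ℝ → E) :
    ∫ t, f t ∂timeMeasure T = ∫ t in (0 : ℝ)..T, f t := by
  rw [intervalIntegral.integral_of_le hT.le, integral_Ioc_eq_integral_Ioo]

theorem eq_zero_of_notMem_tsupport {φ : ℝ → ℝ} {s : Set ℝ} (hs : tsupport φ ⊆ s) {t : ℝ}
    (ht : t ∉ s) : φ t = 0 :=
  image_eq_zero_of_notMem_tsupport fun h => ht (hs h)

theorem integrable_smul_of_hasCompactSupport {T : ℝ} {ψ : ℝ → ℝ} (hψ : Continuous ψ)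
    (hc : HasCompactSupport ψ) {z : ℝ → E} (hz : Integrable z (timeMeasure T)) :
    Integrable (fun t => ψ t • z t) (timeMeasure T) := by
  obtain ⟨M, hM⟩ := hc.exists_bound_of_continuous hψ
  exact hz.bdd_smul M hψ.aestronglyMeasurable (Eventually.of_forall hM)

/-- A smooth function with vanishing integral, compactly supported in `(0,T)`, is the derivative of
such a function. -/
theorem exists_test_primitive {T : ℝ} {η : ℝ → ℝ} (hη : ContDiff ℝ ∞ η)
    {K : Set ℝ} (hK : IsCompact K) (hKn : K.Nonempty) (hKT : K ⊆ Ioo 0 T)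
    (hs : tsupport η ⊆ K) (h0 : ∫ t in (0 : ℝ)..T, η t = 0) :
    ∃ φ : ℝ → ℝ, ContDiff ℝ ∞ φ ∧ HasCompactSupport φ ∧ tsupport φ ⊆ Ioo 0 T ∧ deriv φ = η := by
  have ha := hKT (hK.sInf_mem hKn)
  have hb := hKT (hK.sSup_mem hKn)
  have hz : ∀ t, t ∉ Icc (sInf K) (sSup K) → η t = 0 := fun t ht =>
    eq_zero_of_notMem_tsupport (s := Icc (sInf K) (sSup K)) (hs.trans fun x hx =>
      ⟨csInf_le hK.bddBelow hx, le_csSup hK.bddAbove hx⟩) ht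
  have hd : deriv (fun t => ∫ x in (0 : ℝ)..t, η x) = η := by
    funext t
    exact hη.continuous.deriv_integral η 0 t
  have hi : ∀ a b, IntervalIntegrable η volume a b := fun a b => hη.continuous.intervalIntegrable a b
  have hsupp : tsupport (fun t => ∫ x in (0 : ℝ)..t, η x) ⊆ Icc (sInf K) (sSup K) := by
    refine closure_minimal (fun t ht => ?_) isClosed_Icc
    by_contra hn
    apply ht
    rcases not_and_or.1 hn with h | h
    · push Not at h
      change ∫ x in (0 : ℝ)..t, η x = 0
      rw [intervalIntegral.integral_congr (g := fun _ => 0), intervalIntegral.integral_zero]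
      intro x hx
      apply hz
      rintro ⟨h1, -⟩
      rcases mem_uIcc.1 hx with h2 | h2
      · linarith [h2.2]
      · linarith [h2.2, ha.1]
    · push Not at h
      change ∫ x in (0 : ℝ)..t, η x = 0
      -- To the right of the support the primitive vanishes because the total integral of `η` is
      -- zero.
      rw [← intervalIntegral.integral_add_adjacent_intervals (hi 0 T) (hi T t), h0, zero_add,
        intervalIntegral.integral_congr (g := fun _ => 0), intervalIntegral.integral_zero]
      intro x hx
      apply hz
      rintro ⟨-, h1⟩
      rcases mem_uIcc.1 hx with h2 | h2
      · linarith [h2.1, hb.2]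
      · linarith [h2.1]
  refine ⟨fun t => ∫ x in (0 : ℝ)..t, η x, ?_, ?_, ?_, hd⟩
  · refine contDiff_infty_iff_deriv.2 ⟨fun t =>
      (hη.continuous.integral_hasStrictDerivAt 0 t).hasDerivAt.differentiableAt, ?_⟩
    rw [hd]
    exact hη
  · exact isCompact_Icc.of_isClosed_subset (isClosed_tsupport _) hsupp
  · exact hsupp.trans (Icc_subset_Ioo ha.1 hb.2)

/-- A function with vanishing weak derivative is almost everywhere constant. -/
theorem ae_eq_const_of_integral_deriv_smul_eq_zero [CompleteSpace E] {T : ℝ} (hT : 0 < T)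
    {w : ℝ → E}
    (hw : Integrable w (timeMeasure T))
    (h : ∀ φ : ℝ → ℝ, ContDiff ℝ ∞ φ → HasCompactSupport φ → tsupport φ ⊆ Ioo 0 T →
      ∫ t, deriv φ t • w t ∂timeMeasure T = 0) :
    ∃ c : E, ∀ᵐ t ∂timeMeasure T, w t = c := by
  let b : ContDiffBump (T / 2) := ⟨T / 8, T / 4, by positivity, by linarith⟩
  let ρ : ℝ → ℝ := b.normed volume
  have hρ : ContDiff ℝ ∞ ρ := b.contDiff_normed
  have hρs : tsupport ρ = Metric.closedBall (T / 2) (T / 4) := b.tsupport_normed_eq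
  have hρc : HasCompactSupport ρ := b.hasCompactSupport_normed
  have hρT : tsupport ρ ⊆ Ioo 0 T := by
    rw [hρs, Real.closedBall_eq_Icc]
    exact Icc_subset_Ioo (by linarith) (by linarith)
  have hint : ∀ {ψ : ℝ → ℝ}, tsupport ψ ⊆ Ioo 0 T → ∫ t in (0 : ℝ)..T, ψ t = ∫ t, ψ t := by
    intro ψ hψ
    rw [← integral_timeMeasure hT]
    exact setIntegral_eq_integral_of_forall_compl_eq_zero fun t ht =>
      eq_zero_of_notMem_tsupport hψ ht
  have hρ1 : ∫ t in (0 : ℝ)..T, ρ t = 1 := by rw [hint hρT]; exact b.integral_normed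
  let c : E := ∫ t, ρ t • w t ∂timeMeasure T
  refine ⟨c, ?_⟩
  have hwc : Integrable (fun t => w t - c) (timeMeasure T) := hw.sub (integrable_const c)
  have key := isOpen_Ioo.ae_eq_zero_of_integral_contDiff_smul_eq_zero (U := Ioo 0 T)
    (f := fun t => w t - c) (μ := volume) (IntegrableOn.locallyIntegrableOn hwc) ?_
  · rw [ae_restrict_iff' measurableSet_Ioo]
    filter_upwards [key] with t ht hm using sub_eq_zero.1 (ht hm)
  intro ψ hψ hψc hψT
  rw [← setIntegral_eq_integral_of_forall_compl_eq_zero (s := Ioo 0 T) fun t ht => by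
    rw [eq_zero_of_notMem_tsupport hψT ht, zero_smul]]
  set m : ℝ := ∫ t in (0 : ℝ)..T, ψ t with hm
  have hηs : tsupport (fun t => ψ t - m * ρ t) ⊆ tsupport ψ ∪ tsupport ρ := by
    refine closure_minimal (fun t ht => ?_) ((isClosed_tsupport _).union (isClosed_tsupport _))
    by_contra hn
    rw [mem_union, not_or] at hn
    apply ht
    change ψ t - m * ρ t = 0
    rw [image_eq_zero_of_notMem_tsupport hn.1, image_eq_zero_of_notMem_tsupport hn.2]
    simp
  -- Subtracting `m` times the normalized bump makes the mean value zero, so the difference is the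
  -- derivative of a test function. The bump also makes the compact set nonempty when `ψ` is zero.
  obtain ⟨φ, h1, h2, h3, h4⟩ := exists_test_primitive (T := T) (η := fun t => ψ t - m * ρ t)
    (hψ.sub (contDiff_const.mul hρ)) (hψc.isCompact.union hρc.isCompact)
    (by
      rw [hρs]
      exact ⟨T / 2, Or.inr (Metric.mem_closedBall_self (by positivity))⟩)
    (union_subset hψT hρT) hηs
    (by
      rw [intervalIntegral.integral_sub (hψ.continuous.intervalIntegrable _ _)
        ((hρ.continuous.const_mul m |>.intervalIntegrable _ _)),
        intervalIntegral.integral_const_mul, hρ1, mul_one, sub_self])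
  have hφ := h φ h1 h2 h3
  rw [h4] at hφ
  have e1 : ∫ t, (ψ t - m * ρ t) • w t ∂timeMeasure T
      = (∫ t, ψ t • w t ∂timeMeasure T) - m • c := by
    simp only [sub_smul, mul_smul]
    have hi := (integrable_smul_of_hasCompactSupport hρ.continuous hρc hw).smul m
    simp only [Pi.smul_def] at hi
    rw [integral_sub (integrable_smul_of_hasCompactSupport hψ.continuous hψc hw) hi, integral_smul]
  have e2 : ∫ t, ψ t • (w t - c) ∂timeMeasure T = (∫ t, ψ t • w t ∂timeMeasure T) - m • c := by
    simp only [smul_sub]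
    rw [integral_sub (integrable_smul_of_hasCompactSupport hψ.continuous hψc hw)
      (integrable_smul_of_hasCompactSupport hψ.continuous hψc (integrable_const c)),
      integral_smul_const, hm, ← integral_timeMeasure hT]
  rw [e2, ← e1, hφ]

/-- A function with an integrable weak derivative is almost everywhere equal to a primitive of its
weak derivative. -/
theorem exists_isPrimitiveOn [CompleteSpace E] {T : ℝ} (hT : 0 < T) {f g : ℝ → E}
    (hf : Integrable f (timeMeasure T)) (hg : Integrable g (timeMeasure T))
    (h : ∀ φ : ℝ → ℝ, ContDiff ℝ ∞ φ → HasCompactSupport φ → tsupport φ ⊆ Ioo 0 T →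
      ∫ t, deriv φ t • f t ∂timeMeasure T = - ∫ t, φ t • g t ∂timeMeasure T) :
    ∃ Y : ℝ → E, IsPrimitiveOn Y g 0 T ∧ ∀ᵐ t ∂timeMeasure T, Y t = f t := by
  have hgi := intervalIntegrable_of_timeMeasure hT hg
  let Y₀ : ℝ → E := fun t => ∫ x in (0 : ℝ)..t, g x
  have hY₀ : IsPrimitiveOn Y₀ g 0 T := ⟨hgi, fun x _ => by simp [Y₀]⟩
  have hY₀i : Integrable Y₀ (timeMeasure T) := by
    have hc := hY₀.continuousOn
    rw [uIcc_of_le hT.le] at hc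
    exact (hc.integrableOn_Icc).mono_set Ioo_subset_Icc_self
  -- The difference of `f` and the primitive of `g` has weak derivative zero: integration by parts
  -- for `φ` and `Y₀` has no boundary terms.
  obtain ⟨c, hc⟩ := ae_eq_const_of_integral_deriv_smul_eq_zero hT (hf.sub hY₀i) (by
    intro φ h1 h2 h3
    have hd : Continuous (deriv φ) := h1.continuous_deriv (by norm_num)
    have hφp : IsPrimitiveOn φ (deriv φ) 0 T := ⟨hd.intervalIntegrable _ _, fun x _ => by
      rw [intervalIntegral.integral_deriv_eq_sub (fun t _ => (h1.differentiable (by simp)) t)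
        (hd.intervalIntegrable _ _)]
      ring⟩
    have hI := hφp.integral_bilin hY₀ (ContinuousLinearMap.lsmul ℝ ℝ)
    have hφT : φ T = 0 := eq_zero_of_notMem_tsupport h3 (by simp)
    have hφ0 : φ 0 = 0 := eq_zero_of_notMem_tsupport h3 (by simp)
    simp only [ContinuousLinearMap.lsmul_apply, hφT, hφ0, zero_smul, sub_self] at hI
    rw [← integral_timeMeasure hT, integral_add
      (integrable_smul_of_hasCompactSupport hd h2.deriv hY₀i)
      (integrable_smul_of_hasCompactSupport h1.continuous h2 hg)] at hI
    simp only [Pi.sub_apply, smul_sub]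
    rw [integral_sub (integrable_smul_of_hasCompactSupport hd h2.deriv hf)
      (integrable_smul_of_hasCompactSupport hd h2.deriv hY₀i), h φ h1 h2 h3,
      ← neg_eq_zero, neg_sub, sub_neg_eq_add]
    exact hI)
  refine ⟨fun t => c + Y₀ t, ⟨hgi, fun x _ => by simp [Y₀]⟩, ?_⟩
  filter_upwards [hc] with t ht
  rw [← ht]
  simp

end WeakDerivative

/-! ### Resolvent regularization for a positive operator. -/

section Regularization

variable {V : Type*} [NormedAddCommGroup V] [InnerProductSpace ℝ V]

/-- Bounded operators `S n` commuting with the operator `K`, such that the operators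
`K ∘ S n` are contractions that converge strongly to the identity. -/
structure IsRegularization (K : V →L[ℝ] V) (S : ℕ → V →L[ℝ] V) : Prop where
  comm : ∀ n v, K (S n v) = S n (K v)
  norm_le : ∀ n v, ‖K (S n v)‖ ≤ ‖v‖
  tendsto : ∀ v, Tendsto (fun n => K (S n v)) atTop (𝓝 v)

/-- By positivity of `K`, the operator `K + ε` is coercive, so Lax–Milgram inverts it. -/
theorem exists_resolvent [CompleteSpace V] {K : V →L[ℝ] V}
    (hp : ∀ v, 0 ≤ ⟪K v, v⟫_ℝ) {ε : ℝ} (hε : 0 < ε) :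
    ∃ S : V →L[ℝ] V, (∀ v, K (S v) + ε • S v = v) ∧ (∀ v, K (S v) = S (K v)) ∧
      (∀ v, ‖K (S v)‖ ≤ ‖v‖) ∧ ∀ v, ‖ε • S v‖ ≤ ‖v‖ := by
  let B : V →L[ℝ] V →L[ℝ] ℝ := (innerSL ℝ).comp (K + ε • ContinuousLinearMap.id ℝ V)
  have hB : IsCoercive B := ⟨ε, hε, fun v => by
    have := hp v
    simp only [B, ContinuousLinearMap.comp_apply, add_apply,
      smul_apply, ContinuousLinearMap.id_apply, innerSL_apply_apply,
      inner_add_left, real_inner_smul_left, real_inner_self_eq_norm_mul_norm]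
    nlinarith⟩
  let e := hB.continuousLinearEquivOfBilin
  have he : ∀ v, e v = K v + ε • v := fun v => by
    refine ext_inner_right ℝ fun w => ?_
    rw [hB.continuousLinearEquivOfBilin_apply]
    rfl
  have h1 : ∀ v, K (e.symm v) + ε • e.symm v = v := fun v => by rw [← he, e.apply_symm_apply]
  -- The cross term `2 ε ⟪K z, z⟫` is nonnegative, which gives both contraction bounds at once.
  have hn : ∀ z, ‖K z‖ ^ 2 + ‖ε • z‖ ^ 2 ≤ ‖K z + ε • z‖ ^ 2 := fun z => by
    rw [norm_add_sq_real, real_inner_smul_right]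
    have := mul_nonneg hε.le (hp z)
    linarith
  refine ⟨e.symm, h1, fun v => ?_, fun v => ?_, fun v => ?_⟩
  · simp only [ContinuousLinearEquiv.coe_coe]
    apply e.injective
    have : e (K (e.symm v)) = K (e (e.symm v)) := by simp [he]
    rw [this]
    simp
  · have := hn (e.symm v)
    rw [h1] at this
    simp only [ContinuousLinearEquiv.coe_coe]
    exact abs_le_of_sq_le_sq' (by nlinarith [sq_nonneg ‖ε • e.symm v‖]) (norm_nonneg _) |>.2
  · have := hn (e.symm v)
    rw [h1] at this
    simp only [ContinuousLinearEquiv.coe_coe]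
    exact abs_le_of_sq_le_sq' (by nlinarith [sq_nonneg ‖K (e.symm v)‖]) (norm_nonneg _) |>.2

/-- With `ε = 1/(n+1)`, the error `K (S n v) - v` equals `-ε S n v`. On the range of `K` it is of
order `ε`, since `S n K = K S n` is a contraction; the range is dense because `K` is symmetric and
injective, and the operators `ε S n` are uniformly bounded. -/
theorem exists_isRegularization [CompleteSpace V] {K : V →L[ℝ] V}
    (hs : ∀ v w, ⟪K v, w⟫_ℝ = ⟪v, K w⟫_ℝ) (hp : ∀ v, 0 ≤ ⟪K v, v⟫_ℝ)
    (hi : Function.Injective K) : ∃ S, IsRegularization K S := by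
  have hε : ∀ n : ℕ, (0 : ℝ) < 1 / ((n : ℝ) + 1) := fun n => by positivity
  choose S h1 h2 h4 h5 using fun n => exists_resolvent hp (hε n)
  refine ⟨S, h2, h4, fun v => ?_⟩
  have hd : Dense (LinearMap.range (K : V →ₗ[ℝ] V) : Set V) := by
    rw [Submodule.dense_iff_topologicalClosure_eq_top, Submodule.topologicalClosure_eq_top_iff,
      Submodule.eq_bot_iff]
    intro w hw
    apply hi
    rw [map_zero]
    refine ext_inner_right ℝ fun z => ?_
    rw [hs, real_inner_comm, inner_zero_left]
    exact (Submodule.mem_orthogonal _ _).1 hw (K z) ⟨z, rfl⟩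
  rw [Metric.tendsto_atTop]
  intro δ hδ
  obtain ⟨_, hw, w, rfl⟩ := Metric.dense_iff.1 hd v (δ / 2) (half_pos hδ)
  have ht := tendsto_one_div_add_atTop_nhds_zero_nat (𝕜 := ℝ) |>.mul_const ‖w‖
  rw [zero_mul] at ht
  obtain ⟨N, hN⟩ := Metric.tendsto_atTop.1 ht (δ / 2) (half_pos hδ)
  refine ⟨N, fun n hn => ?_⟩
  have e1 : K (S n v) - v = -((1 / ((n : ℝ) + 1)) • S n (v - K w) +
      (1 / ((n : ℝ) + 1)) • K (S n w)) := by
    have := h1 n v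
    rw [h2 n w, ← smul_add, map_sub, sub_add_cancel, eq_neg_iff_add_eq_zero, sub_add_eq_add_sub, this,
      sub_self]
  have e2 := hN n hn
  rw [Real.dist_eq, sub_zero, abs_of_nonneg (mul_nonneg (hε n).le (norm_nonneg _))] at e2
  rw [dist_eq_norm, e1, norm_neg]
  calc _ ≤ ‖(1 / ((n : ℝ) + 1)) • S n (v - K w)‖ + ‖(1 / ((n : ℝ) + 1)) • K (S n w)‖ :=
        norm_add_le _ _
    _ ≤ ‖v - K w‖ + 1 / ((n : ℝ) + 1) * ‖w‖ := by
        gcongr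
        · exact h5 n _
        · rw [norm_smul, Real.norm_of_nonneg (hε n).le]
          have := (hε n).le
          gcongr
          exact h4 n w
    _ < δ / 2 + δ / 2 := by
        refine add_lt_add ?_ e2
        rw [Metric.mem_ball, dist_comm, dist_eq_norm] at hw
        exact hw
    _ = δ := add_halves δ

end Regularization

/-! ### The Gram operator of the embedding. -/

section Embedding

variable {V H : Type*}
  [NormedAddCommGroup V] [InnerProductSpace ℝ V] [CompleteSpace V]
  [NormedAddCommGroup H] [InnerProductSpace ℝ H] [CompleteSpace H]

/-- The operator `K` on `V` with `⟪K v, w⟫_V = ⟪ι v, ι w⟫_H`. -/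
def gram (ι : V →L[ℝ] H) : V →L[ℝ] V := (ContinuousLinearMap.adjoint ι).comp ι

variable (ι : V →L[ℝ] H)

theorem inner_gram (v w : V) : ⟪gram ι v, w⟫_ℝ = ⟪ι v, ι w⟫_ℝ :=
  ContinuousLinearMap.adjoint_inner_left ι w (ι v)

theorem inner_gram' (v w : V) : ⟪v, gram ι w⟫_ℝ = ⟪ι v, ι w⟫_ℝ :=
  ContinuousLinearMap.adjoint_inner_right ι v (ι w)

theorem toDual_symm_toDualOf (v : V) :
    (InnerProductSpace.toDual ℝ V).symm (toDualOf ι v) = gram ι v := by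
  refine ext_inner_right ℝ fun w => ?_
  rw [InnerProductSpace.toDual_symm_apply, inner_gram]
  rfl

theorem exists_isRegularization_gram (hι : Function.Injective ι) :
    ∃ S, IsRegularization (gram ι) S := by
  refine exists_isRegularization (fun v w => by rw [inner_gram, inner_gram'])
    (fun v => by rw [inner_gram]; exact real_inner_self_nonneg) ?_
  refine (injective_iff_map_eq_zero _).2 fun v hv => ?_
  have := inner_gram ι v v
  rw [hv, inner_zero_left, eq_comm, inner_self_eq_zero] at this
  exact (injective_iff_map_eq_zero ι).1 hι v this

end Embedding

/-! ### Integrability of pairings and comparison of integrals on subintervals. -/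

section SquareIntegrable

variable {T : ℝ}

theorem integrable_of_memLp_two {E : Type*} [NormedAddCommGroup E] {f : ℝ → E}
    (hf : MemLp f 2 (timeMeasure T)) : Integrable f (timeMeasure T) :=
  hf.integrable (by norm_num)

theorem integrable_norm_mul_norm {E F : Type*} [NormedAddCommGroup E] [NormedAddCommGroup F]
    {f : ℝ → E} {g : ℝ → F} (hf : MemLp f 2 (timeMeasure T)) (hg : MemLp g 2 (timeMeasure T)) :
    Integrable (fun t => ‖f t‖ * ‖g t‖) (timeMeasure T) :=
  MemLp.integrable_mul hf.norm hg.norm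

theorem integrable_inner {E : Type*} [NormedAddCommGroup E] [InnerProductSpace ℝ E]
    {f g : ℝ → E} (hf : MemLp f 2 (timeMeasure T)) (hg : MemLp g 2 (timeMeasure T)) :
    Integrable (fun t => ⟪f t, g t⟫_ℝ) (timeMeasure T) :=
  (integrable_norm_mul_norm hf hg).mono (hf.1.inner hg.1)
    (.of_forall fun t => by
      rw [norm_mul, norm_norm, norm_norm]
      exact norm_inner_le_norm _ _)

theorem integrable_dual_apply {V : Type*} [NormedAddCommGroup V] [NormedSpace ℝ V]
    {f : ℝ → StrongDual ℝ V} {g : ℝ → V}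
    (hf : MemLp f 2 (timeMeasure T)) (hg : MemLp g 2 (timeMeasure T)) :
    Integrable (fun t => f t (g t)) (timeMeasure T) :=
  (integrable_norm_mul_norm hf hg).mono
    ((ContinuousLinearMap.id ℝ (StrongDual ℝ V)).aestronglyMeasurable_comp₂ hf.1 hg.1)
    (.of_forall fun t => by
      rw [norm_mul, norm_norm, norm_norm]
      exact (f t).le_opNorm _)

theorem ae_uIoc_of_ae_timeMeasure {P : ℝ → Prop} (h : ∀ᵐ t ∂timeMeasure T, P t) {s t : ℝ}
    (hs : s ∈ Icc 0 T) (ht : t ∈ Icc 0 T) : ∀ᵐ x, x ∈ uIoc s t → P x := by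
  rw [ae_restrict_iff' measurableSet_Ioo] at h
  -- The half-open interval may contain the endpoint `T`, which lies outside `(0,T)`.
  have hne : ∀ᵐ x : ℝ, x ≠ T := by simp [ae_iff, measure_singleton]
  filter_upwards [h, hne] with x hx hxT hm
  rcases mem_uIoc.1 hm with h1 | h1
  · exact hx ⟨lt_of_le_of_lt hs.1 h1.1, lt_of_le_of_ne (h1.2.trans ht.2) hxT⟩
  · exact hx ⟨lt_of_le_of_lt ht.1 h1.1, lt_of_le_of_ne (h1.2.trans hs.2) hxT⟩

theorem abs_intervalIntegral_le {f g : ℝ → ℝ} (hg : Integrable g (timeMeasure T))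
    (hfg : ∀ x, |f x| ≤ g x) {s t : ℝ} (hs : s ∈ Icc 0 T) (ht : t ∈ Icc 0 T) :
    |∫ x in s..t, f x| ≤ ∫ x, g x ∂timeMeasure T := by
  have hg0 : ∀ x, 0 ≤ g x := fun x => (abs_nonneg _).trans (hfg x)
  have hgT : IntegrableOn g (Ioc 0 T) := by
    rw [integrableOn_Ioc_iff_integrableOn_Ioo]; exact hg
  have hsub : uIoc s t ⊆ Ioc 0 T := by
    intro x hx
    rcases mem_uIoc.1 hx with h1 | h1
    · exact ⟨lt_of_le_of_lt hs.1 h1.1, h1.2.trans ht.2⟩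
    · exact ⟨lt_of_le_of_lt ht.1 h1.1, h1.2.trans hs.2⟩
  calc |∫ x in s..t, f x| ≤ ∫ x in uIoc s t, ‖f x‖ :=
        intervalIntegral.norm_integral_le_integral_norm_uIoc (f := f)
    _ ≤ ∫ x in uIoc s t, g x :=
        integral_mono_of_nonneg (.of_forall fun x => norm_nonneg _) (hgT.mono_set hsub)
          (.of_forall hfg)
    _ ≤ ∫ x in Ioc 0 T, g x := setIntegral_mono_set hgT (.of_forall hg0) hsub.eventuallyLE
    _ = ∫ x, g x ∂timeMeasure T := integral_Ioc_eq_integral_Ioo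

end SquareIntegrable

/-! ### Elements of `W(0,T)` seen through the Gram operator. -/

section StateSpace
variable {V H : Type*}
  [NormedAddCommGroup V] [InnerProductSpace ℝ V]
  [NormedAddCommGroup H] [InnerProductSpace ℝ H]
  {T : ℝ} {ι : V →L[ℝ] H}

theorem memLp_val (y : stateSpace T ι) : MemLp (val y) 2 (timeMeasure T) := Lp.memLp y.1.1

theorem memLp_timeDeriv (y : stateSpace T ι) : MemLp (timeDeriv y) 2 (timeMeasure T) :=
  Lp.memLp y.1.2

variable [CompleteSpace V]

/-- The inverse Riesz isomorphism `V' → V` as a continuous linear map. -/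
def rieszRep (V : Type*) [NormedAddCommGroup V] [InnerProductSpace ℝ V] [CompleteSpace V] :
    StrongDual ℝ V →L[ℝ] V :=
  LinearMap.mkContinuous
    { toFun := fun g => (InnerProductSpace.toDual ℝ V).symm g
      map_add' := fun a b => map_add _ a b
      map_smul' := fun c a => by simp } 1 fun g => by simp

theorem inner_rieszRep (g : StrongDual ℝ V) (v : V) : ⟪rieszRep V g, v⟫_ℝ = g v :=
  InnerProductSpace.toDual_symm_apply

/-- The Riesz representative in `V` of the weak time derivative. -/
def rieszDeriv (y : stateSpace T ι) (t : ℝ) : V :=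
  rieszRep V (timeDeriv y t)

theorem inner_rieszDeriv (y : stateSpace T ι) (t : ℝ) (v : V) :
    ⟪rieszDeriv y t, v⟫_ℝ = timeDeriv y t v :=
  inner_rieszRep _ _

theorem memLp_rieszDeriv (y : stateSpace T ι) : MemLp (rieszDeriv y) 2 (timeMeasure T) :=
  (rieszRep V).comp_memLp' (memLp_timeDeriv y)

variable [CompleteSpace H]

/-- The inverse Riesz isomorphism carries the embedding of `V` into `V'` to `gram ι`. Applied to the
definition of the weak derivative, it turns an identity in `V'` into one in `V`. -/
theorem exists_isPrimitiveOn_gram (hT : 0 < T) (y : stateSpace T ι) :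
    ∃ Y, IsPrimitiveOn Y (rieszDeriv y) 0 T ∧ ∀ᵐ t ∂timeMeasure T, Y t = gram ι (val y t) := by
  have hK : MemLp (fun t => gram ι (val y t)) 2 (timeMeasure T) :=
    (gram ι).comp_memLp' (memLp_val y)
  refine exists_isPrimitiveOn hT (integrable_of_memLp_two hK)
    (integrable_of_memLp_two (memLp_rieszDeriv y)) fun φ h1 h2 h3 => ?_
  have hR := congrArg (rieszRep V) (y.2 φ h1 h2 h3)
  change rieszRep V (∫ t, deriv φ t • toDualOf ι (val y t) ∂timeMeasure T) =
    rieszRep V (-∫ t, φ t • timeDeriv y t ∂timeMeasure T) at hR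
  rw [map_neg, ← (rieszRep V).integral_comp_comm (integrable_test_smul
      (h1.continuous_deriv (by norm_num)) h2.deriv (memLp_toDualOf ι (memLp_val y))),
    ← (rieszRep V).integral_comp_comm (integrable_test_smul h1.continuous h2 (memLp_timeDeriv y))] at hR
  have hg : ∀ v, rieszRep V (toDualOf ι v) = gram ι v := toDual_symm_toDualOf ι
  simp only [map_smul, hg] at hR
  exact hR

variable {S S' : V →L[ℝ] V}

/-- Integration by parts for regularized elements of the state space. -/
theorem inner_regularized_sub {y z : stateSpace T ι} {Y Z : ℝ → V} (hT : 0 < T)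
    (hY : IsPrimitiveOn Y (rieszDeriv y) 0 T)
    (hYv : ∀ᵐ t ∂timeMeasure T, Y t = gram ι (val y t))
    (hZ : IsPrimitiveOn Z (rieszDeriv z) 0 T)
    (hZv : ∀ᵐ t ∂timeMeasure T, Z t = gram ι (val z t))
    (hc : ∀ v, gram ι (S v) = S (gram ι v)) (hc' : ∀ v, gram ι (S' v) = S' (gram ι v))
    {s t : ℝ} (hs : s ∈ Icc 0 T) (ht : t ∈ Icc 0 T) :
    ⟪ι (S (Y t)), ι (S' (Z t))⟫_ℝ - ⟪ι (S (Y s)), ι (S' (Z s))⟫_ℝ =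
      ∫ x in s..t, (⟪gram ι (S (rieszDeriv y x)), gram ι (S' (val z x))⟫_ℝ +
        ⟪gram ι (S (val y x)), gram ι (S' (rieszDeriv z x))⟫_ℝ) := by
  rw [← uIcc_of_le hT.le] at hs ht
  have h := ((hY.mono hs ht).comp_clm S).integral_bilin ((hZ.mono hs ht).comp_clm S')
    ((innerSL ℝ).bilinearComp ι ι)
  simp only [ContinuousLinearMap.bilinearComp_apply, innerSL_apply_apply] at h
  rw [← h]
  rw [uIcc_of_le hT.le] at hs ht
  apply intervalIntegral.integral_congr_ae
  filter_upwards [ae_uIoc_of_ae_timeMeasure hYv hs ht, ae_uIoc_of_ae_timeMeasure hZv hs ht]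
    with x h1 h2 hx
  -- Moving one Gram operator across the inner product puts `K S` and `K S'` on the two factors, the
  -- combinations that stay bounded and converge in the limit.
  rw [h1 hx, h2 hx, ← hc, ← hc', ← inner_gram ι (S (rieszDeriv y x)),
    ← inner_gram' ι (gram ι (S (val y x)))]

end StateSpace

section Uniqueness

variable {V H : Type*}
  [NormedAddCommGroup V] [InnerProductSpace ℝ V]
  [NormedAddCommGroup H] [InnerProductSpace ℝ H]
  {T : ℝ} {ι : V →L[ℝ] H}

theorem IsContinuousRep.eqOn (hT : 0 < T) {y : stateSpace T ι} {c c' : ℝ → H}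
    (h : IsContinuousRep y c) (h' : IsContinuousRep y c') : EqOn c c' (Icc 0 T) := by
  have hae : c =ᵐ[volume.restrict (Icc 0 T)] c' := by
    rw [← restrict_Ioo_eq_restrict_Icc]
    filter_upwards [h.2, h'.2] with t h1 h2
    rw [h1, h2]
  exact Measure.eqOn_Icc_of_ae_eq volume hT.ne hae h.1 h'.1

end Uniqueness

/-! ### The embedding of `W(0,T)` into `C([0,T];H)` and integration by parts. -/

section ContinuousRep

variable {V H : Type*}
  [NormedAddCommGroup V] [InnerProductSpace ℝ V] [CompleteSpace V]
  [NormedAddCommGroup H] [InnerProductSpace ℝ H] [CompleteSpace H]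
  {T : ℝ} {ι : V →L[ℝ] H} {S : ℕ → V →L[ℝ] V}

theorem integral_const_timeMeasure (hT : 0 < T) (c : ℝ) : ∫ _, c ∂timeMeasure T = T * c := by
  simp [Real.volume_real_Ioo_of_le hT.le]

theorem memLp_regularized_sub (n : ℕ) (y : stateSpace T ι) :
    MemLp (fun x => gram ι (S n (val y x)) - val y x) 2 (timeMeasure T) :=
  ((gram ι).comp (S n) - ContinuousLinearMap.id ℝ V).comp_memLp' (memLp_val y)

/-- The error in the approximation of `y` by `K ∘ S n`. -/
def regularizationError (S : ℕ → V →L[ℝ] V) (y : stateSpace T ι) (n : ℕ) : ℝ :=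
  2 * ‖ι‖ ^ 2 * (∫ x, ‖gram ι (S n (val y x)) - val y x‖ ^ 2 ∂timeMeasure T) +
    4 * T * ∫ x, ‖rieszDeriv y x‖ * ‖gram ι (S n (val y x)) - val y x‖ ∂timeMeasure T

theorem tendsto_regularizationError (hS : IsRegularization (gram ι) S) (y : stateSpace T ι) :
    Tendsto (regularizationError S y) atTop (𝓝 0) := by
  have hle : ∀ n x, ‖gram ι (S n (val y x)) - val y x‖ ≤ 2 * ‖val y x‖ := fun n x => by
    refine (norm_sub_le _ _).trans ?_
    linarith [hS.norm_le n (val y x)]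
  have hlim : ∀ x, Tendsto (fun n => ‖gram ι (S n (val y x)) - val y x‖) atTop (𝓝 0) := fun x => by
    have := ((hS.tendsto (val y x)).sub_const (val y x)).norm
    simpa using this
  have h1 : Tendsto (fun n => ∫ x, ‖gram ι (S n (val y x)) - val y x‖ ^ 2 ∂timeMeasure T) atTop
      (𝓝 (∫ _, (0 : ℝ) ∂timeMeasure T)) := by
    refine tendsto_integral_of_dominated_convergence (fun x => 4 * (‖val y x‖ * ‖val y x‖))
      (fun n => ((memLp_regularized_sub n y).1.norm.pow 2))
      ((integrable_norm_mul_norm (memLp_val y) (memLp_val y)).const_mul 4)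
      (fun n => .of_forall fun x => ?_) (.of_forall fun x => by simpa using (hlim x).pow 2)
    rw [Real.norm_of_nonneg (sq_nonneg _)]
    nlinarith [hle n x, norm_nonneg (gram ι (S n (val y x)) - val y x), norm_nonneg (val y x)]
  have h2 : Tendsto (fun n => ∫ x, ‖rieszDeriv y x‖ * ‖gram ι (S n (val y x)) - val y x‖
      ∂timeMeasure T) atTop (𝓝 (∫ _, (0 : ℝ) ∂timeMeasure T)) := by
    refine tendsto_integral_of_dominated_convergence
      (fun x => 2 * (‖rieszDeriv y x‖ * ‖val y x‖))
      (fun n => (memLp_rieszDeriv y).1.norm.mul (memLp_regularized_sub n y).1.norm)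
      ((integrable_norm_mul_norm (memLp_rieszDeriv y) (memLp_val y)).const_mul 2)
      (fun n => .of_forall fun x => ?_)
      (.of_forall fun x => by simpa using (hlim x).const_mul ‖rieszDeriv y x‖)
    rw [Real.norm_of_nonneg (by positivity)]
    nlinarith [hle n x, norm_nonneg (rieszDeriv y x)]
  rw [integral_zero] at h1 h2
  have := (h1.const_mul (2 * ‖ι‖ ^ 2)).add (h2.const_mul (4 * T))
  simp only [mul_zero, add_zero] at this
  exact this

/-- Integration by parts for `D = S n - S m` compares the value at `t` with the value at any `s`;
averaging over `s` replaces the unknown value at `s` by an `L²` norm. The bound does not depend on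
`t`, which yields uniform convergence. -/
theorem norm_regularized_sub_sq_le (hT : 0 < T) (hS : IsRegularization (gram ι) S)
    {y : stateSpace T ι} {Y : ℝ → V} (hY : IsPrimitiveOn Y (rieszDeriv y) 0 T)
    (hYv : ∀ᵐ t ∂timeMeasure T, Y t = gram ι (val y t)) (n m : ℕ) {t : ℝ} (ht : t ∈ Icc 0 T) :
    T * ‖ι (S n (Y t)) - ι (S m (Y t))‖ ^ 2 ≤
      regularizationError S y n + regularizationError S y m := by
  let e : ℕ → ℝ → ℝ := fun n x => ‖gram ι (S n (val y x)) - val y x‖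
  let D : V →L[ℝ] V := S n - S m
  have hD : ∀ v, gram ι (D v) = D (gram ι v) := fun v => by
    simp [D, hS.comm]
  have hDv : ∀ x, ‖gram ι (D (val y x))‖ ≤ e n x + e m x := fun x => by
    have : gram ι (D (val y x)) = (gram ι (S n (val y x)) - val y x) -
      (gram ι (S m (val y x)) - val y x) := by simp [D]
    rw [this]
    exact norm_sub_le _ _
  have hDg : ∀ x, ‖gram ι (D (rieszDeriv y x))‖ ≤ 2 * ‖rieszDeriv y x‖ := fun x => by
    have : gram ι (D (rieszDeriv y x)) = gram ι (S n (rieszDeriv y x)) -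
      gram ι (S m (rieszDeriv y x)) := by simp [D]
    rw [this]
    refine (norm_sub_le _ _).trans ?_
    linarith [hS.norm_le n (rieszDeriv y x), hS.norm_le m (rieszDeriv y x)]
  have hin : ∀ k, Integrable (fun x => ‖rieszDeriv y x‖ * e k x) (timeMeasure T) := fun k =>
    integrable_norm_mul_norm (memLp_rieszDeriv y) (memLp_regularized_sub k y)
  have hi2 : ∀ k, Integrable (fun x => e k x ^ 2) (timeMeasure T) := fun k => by
    simpa only [sq] using
      integrable_norm_mul_norm (memLp_regularized_sub (S := S) k y) (memLp_regularized_sub k y)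
  have hig : Integrable (fun x => 4 * (‖rieszDeriv y x‖ * e n x + ‖rieszDeriv y x‖ * e m x))
      (timeMeasure T) := ((hin n).add (hin m)).const_mul 4
  -- One factor 2 comes from the two equal terms of the product rule, the other from bounding `K D`
  -- on the derivative by twice its norm.
  set I : ℝ := 4 * ((∫ x, ‖rieszDeriv y x‖ * e n x ∂timeMeasure T) +
    ∫ x, ‖rieszDeriv y x‖ * e m x ∂timeMeasure T) with hI
  have hstep : ∀ s ∈ Icc 0 T, ‖ι (D (Y t))‖ ^ 2 ≤ ‖ι (D (Y s))‖ ^ 2 + I := by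
    intro s hs
    have h := inner_regularized_sub hT hY hYv hY hYv hD hD hs ht
    have h' := abs_intervalIntegral_le (f := fun x =>
      ⟪gram ι (D (rieszDeriv y x)), gram ι (D (val y x))⟫_ℝ +
        ⟪gram ι (D (val y x)), gram ι (D (rieszDeriv y x))⟫_ℝ) hig (fun x => by
      rw [real_inner_comm, ← two_mul, abs_mul, abs_two]
      have h1 := abs_real_inner_le_norm (gram ι (D (val y x))) (gram ι (D (rieszDeriv y x)))
      have h2 := mul_le_mul (hDv x) (hDg x) (norm_nonneg _) ((norm_nonneg _).trans (hDv x))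
      rw [real_inner_comm]
      rw [real_inner_comm] at h1
      nlinarith) hs ht
    rw [← h, integral_const_mul, integral_add (hin n) (hin m), real_inner_self_eq_norm_sq,
      real_inner_self_eq_norm_sq] at h'
    linarith [(abs_le.1 h').2]
  have hcont : ContinuousOn (fun s => ‖ι (D (Y s))‖ ^ 2) (Icc 0 T) := by
    have := hY.continuousOn
    rw [uIcc_of_le hT.le] at this
    exact ((ι.comp D).continuous.comp_continuousOn this).norm.pow 2
  have hci : Integrable (fun s => ‖ι (D (Y s))‖ ^ 2) (timeMeasure T) :=
    hcont.integrableOn_Icc.mono_set Ioo_subset_Icc_self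
  have hm1 : ∫ _, ‖ι (D (Y t))‖ ^ 2 ∂timeMeasure T ≤
      ∫ s, (‖ι (D (Y s))‖ ^ 2 + I) ∂timeMeasure T := by
    refine integral_mono_ae (integrable_const _) (hci.add (integrable_const _)) ?_
    filter_upwards [ae_restrict_mem measurableSet_Ioo] with s hs
    exact hstep s (Ioo_subset_Icc_self hs)
  have hm2 : ∫ s, ‖ι (D (Y s))‖ ^ 2 ∂timeMeasure T ≤
      ∫ s, (2 * ‖ι‖ ^ 2) * (e n s ^ 2 + e m s ^ 2) ∂timeMeasure T := by
    refine integral_mono_ae hci (((hi2 n).add (hi2 m)).const_mul _) ?_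
    filter_upwards [hYv] with s hs
    rw [hs, ← hD]
    have h1 := ι.le_opNorm (gram ι (D (val y s)))
    have h2 := hDv s
    have h3 : ‖ι (gram ι (D (val y s)))‖ ≤ ‖ι‖ * (e n s + e m s) :=
      h1.trans (mul_le_mul_of_nonneg_left h2 (norm_nonneg _))
    calc ‖ι (gram ι (D (val y s)))‖ ^ 2 ≤ (‖ι‖ * (e n s + e m s)) ^ 2 := by gcongr
      _ = ‖ι‖ ^ 2 * (e n s + e m s) ^ 2 := by ring
      _ ≤ ‖ι‖ ^ 2 * (2 * (e n s ^ 2 + e m s ^ 2)) := by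
          gcongr
          nlinarith [sq_nonneg (e n s - e m s)]
      _ = _ := by ring
  rw [integral_const_timeMeasure hT, integral_add hci (integrable_const _),
    integral_const_timeMeasure hT] at hm1
  rw [integral_const_mul, integral_add (hi2 n) (hi2 m)] at hm2
  have : ι (S n (Y t)) - ι (S m (Y t)) = ι (D (Y t)) := by simp [D]
  rw [this, regularizationError, regularizationError]
  calc _ ≤ _ := hm1
    _ ≤ _ := add_le_add_left hm2 _
    _ = _ := by rw [hI]; ring

/-- Elements of the state space have a representative in `C([0,T];H)`, which is the uniform limit
of the regularizations. -/
theorem exists_isContinuousRep_tendsto (hT : 0 < T) (hS : IsRegularization (gram ι) S)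
    {y : stateSpace T ι} {Y : ℝ → V} (hY : IsPrimitiveOn Y (rieszDeriv y) 0 T)
    (hYv : ∀ᵐ t ∂timeMeasure T, Y t = gram ι (val y t)) :
    ∃ c, IsContinuousRep y c ∧
      ∀ t ∈ Icc 0 T, Tendsto (fun n => ι (S n (Y t))) atTop (𝓝 (c t)) := by
  have hU : UniformCauchySeqOn (fun n t => ι (S n (Y t))) atTop (Icc 0 T) := by
    rw [Metric.uniformCauchySeqOn_iff]
    intro ε hε
    obtain ⟨N, hN⟩ := Metric.tendsto_atTop.1 (tendsto_regularizationError hS y) (T * ε ^ 2 / 2)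
      (by positivity)
    refine ⟨N, fun m hm n hn t ht => ?_⟩
    have h1 := abs_lt.1 (by simpa using hN m hm)
    have h2 := abs_lt.1 (by simpa using hN n hn)
    have h3 := norm_regularized_sub_sq_le hT hS hY hYv m n ht
    rw [dist_eq_norm]
    refine lt_of_pow_lt_pow_left₀ 2 hε.le ?_
    have : T * ‖ι (S m (Y t)) - ι (S n (Y t))‖ ^ 2 < T * ε ^ 2 := by linarith [h1.2, h2.2]
    exact lt_of_mul_lt_mul_left this hT.le
  have hlim : ∀ t, ∃ l, t ∈ Icc 0 T → Tendsto (fun n => ι (S n (Y t))) atTop (𝓝 l) := fun t => by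
    by_cases ht : t ∈ Icc 0 T
    · obtain ⟨l, hl⟩ := cauchySeq_tendsto_of_complete (hU.cauchySeq ht)
      exact ⟨l, fun _ => hl⟩
    · exact ⟨0, fun h => absurd h ht⟩
  choose c hc using hlim
  have hTU := hU.tendstoUniformlyOn_of_tendsto fun t ht => hc t ht
  refine ⟨c, ⟨hTU.continuousOn (Eventually.frequently (.of_forall fun n => ?_)), ?_⟩, hc⟩
  · have := hY.continuousOn
    rw [uIcc_of_le hT.le] at this
    exact (ι.comp (S n)).continuous.comp_continuousOn this
  · filter_upwards [hYv, ae_restrict_mem measurableSet_Ioo] with t h1 h2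
    refine tendsto_nhds_unique (hc t (Ioo_subset_Icc_self h2)) ?_
    simp only [h1, ← hS.comm]
    exact (ι.continuous.tendsto _).comp (hS.tendsto _)

theorem exists_isContinuousRep (hT : 0 < T) (hι : Function.Injective ι) (y : stateSpace T ι) :
    ∃ c, IsContinuousRep y c := by
  obtain ⟨S, hS⟩ := exists_isRegularization_gram ι hι
  obtain ⟨Y, hY, hYv⟩ := exists_isPrimitiveOn_gram hT y
  obtain ⟨c, hc, -⟩ := exists_isContinuousRep_tendsto hT hS hY hYv
  exact ⟨c, hc⟩

/-- The default value `0` in `pointValue` never occurs under these hypotheses. -/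
theorem isContinuousRep_pointValue (hT : 0 < T) (hι : Function.Injective ι) (y : stateSpace T ι) :
    IsContinuousRep y (pointValue y) := by
  have h := exists_isContinuousRep hT hι y
  have : pointValue y = h.choose := by
    funext t
    rw [pointValue, dif_pos h]
  rw [this]
  exact h.choose_spec

theorem IsContinuousRep.pointValue_eq (hT : 0 < T) (hι : Function.Injective ι)
    {y : stateSpace T ι} {c : ℝ → H} (h : IsContinuousRep y c) {t : ℝ} (ht : t ∈ Icc 0 T) :
    pointValue y t = c t :=
  (isContinuousRep_pointValue hT hι y).eqOn hT h ht

/-- Integration by parts in the state space. -/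
theorem inner_pointValue_sub (hT : 0 < T) (hι : Function.Injective ι) (y z : stateSpace T ι)
    {s t : ℝ} (hs : s ∈ Icc 0 T) (ht : t ∈ Icc 0 T) :
    ⟪pointValue y t, pointValue z t⟫_ℝ - ⟪pointValue y s, pointValue z s⟫_ℝ =
      ∫ x in s..t, (timeDeriv y x (val z x) + timeDeriv z x (val y x)) := by
  obtain ⟨S, hS⟩ := exists_isRegularization_gram ι hι
  obtain ⟨Y, hY, hYv⟩ := exists_isPrimitiveOn_gram hT y
  obtain ⟨Z, hZ, hZv⟩ := exists_isPrimitiveOn_gram hT z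
  obtain ⟨c, hc, hc'⟩ := exists_isContinuousRep_tendsto hT hS hY hYv
  obtain ⟨d, hd, hd'⟩ := exists_isContinuousRep_tendsto hT hS hZ hZv
  rw [hc.pointValue_eq hT hι ht, hc.pointValue_eq hT hι hs, hd.pointValue_eq hT hι ht,
    hd.pointValue_eq hT hι hs]
  -- The formula holds for each regularization. The left side converges pointwise, the right side by
  -- dominated convergence, since every `K ∘ S n` is a contraction.
  refine tendsto_nhds_unique (((hc' t ht).inner (hd' t ht)).sub ((hc' s hs).inner (hd' s hs))) ?_
  simp only [inner_regularized_sub hT hY hYv hZ hZv (hS.comm _) (hS.comm _) hs ht]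
  have hbi : Integrable (fun x => ‖rieszDeriv y x‖ * ‖val z x‖ + ‖val y x‖ * ‖rieszDeriv z x‖)
      (timeMeasure T) :=
    (integrable_norm_mul_norm (memLp_rieszDeriv y) (memLp_val z)).add
      (integrable_norm_mul_norm (memLp_val y) (memLp_rieszDeriv z))
  have hsub : uIcc s t ⊆ uIcc 0 T := by
    rw [uIcc_of_le hT.le]
    exact uIcc_subset_Icc hs ht
  have hmeas : ∀ {f : ℝ → ℝ}, AEStronglyMeasurable f (timeMeasure T) →
      AEStronglyMeasurable f (volume.restrict (uIoc s t)) := by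
    intro f hf
    rw [timeMeasure, restrict_Ioo_eq_restrict_Icc] at hf
    refine hf.mono_set (uIoc_subset_uIcc.trans ?_)
    rw [← uIcc_of_le hT.le]
    exact hsub
  refine intervalIntegral.tendsto_integral_filter_of_dominated_convergence _
    (.of_forall fun n => hmeas ?_) (.of_forall fun n => .of_forall fun x _ => ?_)
    ((intervalIntegrable_of_timeMeasure hT hbi).mono_set hsub) (.of_forall fun x _ => ?_)
  · have hm : ∀ {w : ℝ → V}, MemLp w 2 (timeMeasure T) →
        AEStronglyMeasurable (fun x => gram ι (S n (w x))) (timeMeasure T) := fun hw =>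
      (((gram ι).comp (S n)).comp_memLp' hw).1
    exact ((hm (memLp_rieszDeriv y)).inner (hm (memLp_val z))).add
      ((hm (memLp_val y)).inner (hm (memLp_rieszDeriv z)))
  · refine (norm_add_le _ _).trans (add_le_add ?_ ?_)
    all_goals
      exact (norm_inner_le_norm _ _).trans
        (mul_le_mul (hS.norm_le _ _) (hS.norm_le _ _) (norm_nonneg _) (norm_nonneg _))
  · have := ((hS.tendsto (rieszDeriv y x)).inner (𝕜 := ℝ) (hS.tendsto (val z x))).add
      ((hS.tendsto (val y x)).inner (𝕜 := ℝ) (hS.tendsto (rieszDeriv z x)))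
    rwa [inner_rieszDeriv, real_inner_comm (rieszDeriv z x) (val y x), inner_rieszDeriv] at this

theorem integral_timeDeriv_add (hT : 0 < T) (hι : Function.Injective ι) (y z : stateSpace T ι) :
    ∫ x, (timeDeriv y x (val z x) + timeDeriv z x (val y x)) ∂timeMeasure T =
      ⟪pointValue y T, pointValue z T⟫_ℝ - ⟪pointValue y 0, pointValue z 0⟫_ℝ := by
  rw [integral_timeMeasure hT, inner_pointValue_sub hT hι y z (left_mem_Icc.2 hT.le)
    (right_mem_Icc.2 hT.le)]

end ContinuousRep

/-! ### Linear operations on representatives and separated functions. -/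

section Values

variable {V H : Type*}
  [NormedAddCommGroup V] [InnerProductSpace ℝ V]
  [NormedAddCommGroup H] [InnerProductSpace ℝ H]
  {T : ℝ} {ι : V →L[ℝ] H}

theorem integral_norm_sq {E : Type*} [NormedAddCommGroup E] (f : Lp E 2 (timeMeasure T)) :
    ∫ t, ‖f t‖ ^ 2 ∂timeMeasure T = ‖f‖ ^ 2 := by
  have h := (Lp.memLp f).eLpNorm_eq_integral_rpow_norm (by norm_num) (by norm_num)
  have h0 : 0 ≤ ∫ t, ‖f t‖ ^ 2 ∂timeMeasure T := integral_nonneg fun t => sq_nonneg _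
  rw [Lp.norm_def, h, ENNReal.toReal_ofReal (by positivity)]
  simp only [ENNReal.toReal_ofNat, Real.rpow_two]
  rw [← Real.rpow_natCast, ← Real.rpow_mul h0]
  norm_num

theorem val_add (y z : stateSpace T ι) :
    ∀ᵐ t ∂timeMeasure T, val (y + z) t = val y t + val z t :=
  Lp.coeFn_add y.1.1 z.1.1

theorem val_smul (k : ℝ) (y : stateSpace T ι) :
    ∀ᵐ t ∂timeMeasure T, val (k • y) t = k • val y t :=
  Lp.coeFn_smul k y.1.1

theorem IsContinuousRep.add {y z : stateSpace T ι} {c d : ℝ → H} (hc : IsContinuousRep y c)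
    (hd : IsContinuousRep z d) : IsContinuousRep (y + z) (fun t => c t + d t) := by
  refine ⟨hc.1.add hd.1, ?_⟩
  filter_upwards [hc.2, hd.2, val_add y z] with t h1 h2 h3
  rw [h1, h2, h3, map_add]

theorem IsContinuousRep.smul {y : stateSpace T ι} {c : ℝ → H} (hc : IsContinuousRep y c) (k : ℝ) :
    IsContinuousRep (k • y) (fun t => k • c t) := by
  refine ⟨hc.1.const_smul k, ?_⟩
  filter_upwards [hc.2, val_smul k y] with t h1 h2
  rw [h1, h2, map_smul]

theorem exists_stateSpace {y : ℝ → V} {g : ℝ → StrongDual ℝ V} (hy : MemLp y 2 (timeMeasure T))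
    (hg : MemLp g 2 (timeMeasure T)) (h : IsWeakTimeDeriv T ι y g) :
    ∃ w : stateSpace T ι, (∀ᵐ t ∂timeMeasure T, val w t = y t) ∧
      ∀ᵐ t ∂timeMeasure T, timeDeriv w t = g t := by
  refine ⟨⟨(hy.toLp, hg.toLp), fun φ h1 h2 h3 => ?_⟩, hy.coeFn_toLp, hg.coeFn_toLp⟩
  have e1 : ∫ t, deriv φ t • toDualOf ι (hy.toLp y t) ∂timeMeasure T =
      ∫ t, deriv φ t • toDualOf ι (y t) ∂timeMeasure T := by
    apply integral_congr_ae
    filter_upwards [hy.coeFn_toLp] with t ht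
    rw [ht]
  have e2 : ∫ t, φ t • hg.toLp g t ∂timeMeasure T = ∫ t, φ t • g t ∂timeMeasure T := by
    apply integral_congr_ae
    filter_upwards [hg.coeFn_toLp] with t ht
    rw [ht]
  rw [e1, e2, h φ h1 h2 h3]

theorem isPrimitiveOn_deriv {ψ : ℝ → ℝ} (hψ : ContDiff ℝ 1 ψ) (a b : ℝ) :
    IsPrimitiveOn ψ (deriv ψ) a b where
  integrable := (hψ.continuous_deriv le_rfl).intervalIntegrable _ _
  eq_add x _ := by
    rw [intervalIntegral.integral_deriv_eq_sub (fun t _ => (hψ.differentiable (by simp)) t)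
      ((hψ.continuous_deriv le_rfl).intervalIntegrable _ _)]
    ring

theorem memLp_smul_const {E : Type*} [NormedAddCommGroup E] [NormedSpace ℝ E] {ψ : ℝ → ℝ}
    (hψ : Continuous ψ) (v : E) : MemLp (fun t => ψ t • v) 2 (timeMeasure T) := by
  obtain ⟨M, hM⟩ := (isCompact_Icc (a := (0 : ℝ)) (b := T)).exists_bound_of_continuousOn
    (hψ.smul (continuous_const (y := v))).continuousOn
  refine MemLp.of_bound (hψ.smul continuous_const).aestronglyMeasurable M ?_
  filter_upwards [ae_restrict_mem measurableSet_Ioo] with t ht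
  exact hM t (Ioo_subset_Icc_self ht)

/-- Separated functions `t ↦ ψ t • v` belong to the state space. -/
theorem exists_stateSpace_smul (hT : 0 < T) {ψ : ℝ → ℝ} (hψ : ContDiff ℝ 1 ψ) (v : V) :
    ∃ w : stateSpace T ι, (∀ᵐ t ∂timeMeasure T, val w t = ψ t • v) ∧
      (∀ᵐ t ∂timeMeasure T, timeDeriv w t = deriv ψ t • toDualOf ι v) ∧
      IsContinuousRep w (fun t => ψ t • ι v) := by
  have hd := hψ.continuous_deriv le_rfl
  obtain ⟨w, hw, hw'⟩ := exists_stateSpace (ι := ι) (memLp_smul_const hψ.continuous v)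
    (memLp_smul_const (T := T) hd (toDualOf ι v)) (fun φ h1 h2 h3 => by
      have hφ1 : ContDiff ℝ 1 φ := h1.of_le (by norm_num)
      have hφd := hφ1.continuous_deriv le_rfl
      have i1 : IntervalIntegrable (fun x => deriv φ x * ψ x) volume 0 T :=
        (hφd.mul hψ.continuous).intervalIntegrable _ _
      have i2 : IntervalIntegrable (fun x => φ x * deriv ψ x) volume 0 T :=
        (hφ1.continuous.mul hd).intervalIntegrable _ _
      have h := (isPrimitiveOn_deriv hφ1 0 T).integral_bilin (isPrimitiveOn_deriv hψ 0 T)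
        (ContinuousLinearMap.mul ℝ ℝ)
      simp only [ContinuousLinearMap.mul_apply'] at h
      rw [eq_zero_of_notMem_tsupport h3 (t := 0) (by simp),
        eq_zero_of_notMem_tsupport h3 (t := T) (by simp), zero_mul, zero_mul, sub_self,
        intervalIntegral.integral_add i1 i2] at h
      simp only [map_smul, smul_smul]
      rw [integral_smul_const, integral_smul_const, integral_timeMeasure hT,
        integral_timeMeasure hT, eq_neg_of_add_eq_zero_left h, neg_smul])
  refine ⟨w, hw, hw', (hψ.continuous.smul continuous_const).continuousOn, ?_⟩
  filter_upwards [hw] with t ht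
  rw [ht, map_smul]

end Values

/-! ### Continuity of the point evaluation. -/

section Trace

variable {V H : Type*}
  [NormedAddCommGroup V] [InnerProductSpace ℝ V] [CompleteSpace V]
  [NormedAddCommGroup H] [InnerProductSpace ℝ H] [CompleteSpace H]
  {T : ℝ} {ι : V →L[ℝ] H}

/-- Integration by parts bounds the change of `‖y(t)‖²` by `‖∂ₜy‖² + ‖y‖²`, at most twice the square
of the max norm; averaging over the comparison time gives the rest. -/
theorem mul_norm_pointValue_sq_le (hT : 0 < T) (hι : Function.Injective ι) (y : stateSpace T ι)
    {t : ℝ} (ht : t ∈ Icc 0 T) :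
    T * ‖pointValue y t‖ ^ 2 ≤ (‖ι‖ ^ 2 + 2 * T) * ‖y‖ ^ 2 := by
  have hrep := isContinuousRep_pointValue hT hι y
  have n1 : ‖y.1.1‖ ≤ ‖y‖ := norm_fst_le y.1
  have n2 : ‖y.1.2‖ ≤ ‖y‖ := norm_snd_le y.1
  have hyy : Integrable (fun x => ‖val y x‖ ^ 2) (timeMeasure T) := by
    simpa only [sq] using integrable_norm_mul_norm (memLp_val y) (memLp_val y)
  have hdd : Integrable (fun x => ‖timeDeriv y x‖ ^ 2) (timeMeasure T) := by
    simpa only [sq] using integrable_norm_mul_norm (memLp_timeDeriv y) (memLp_timeDeriv y)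
  have hig := hdd.add hyy
  have hstep : ∀ s ∈ Icc 0 T, ‖pointValue y t‖ ^ 2 ≤ ‖pointValue y s‖ ^ 2 + 2 * ‖y‖ ^ 2 := by
    intro s hs
    have h := inner_pointValue_sub hT hι y y hs ht
    have h' := abs_intervalIntegral_le (f := fun x =>
      timeDeriv y x (val y x) + timeDeriv y x (val y x)) hig (fun x => by
        rw [← two_mul, abs_mul, abs_two]
        have h1 : |timeDeriv y x (val y x)| ≤ ‖timeDeriv y x‖ * ‖val y x‖ :=
          (timeDeriv y x).le_opNorm _
        simp only [Pi.add_apply]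
        nlinarith [sq_nonneg (‖timeDeriv y x‖ - ‖val y x‖)]) hs ht
    have e1 : ∫ x, ‖timeDeriv y x‖ ^ 2 ∂timeMeasure T = ‖y.1.2‖ ^ 2 := integral_norm_sq y.1.2
    have e2 : ∫ x, ‖val y x‖ ^ 2 ∂timeMeasure T = ‖y.1.1‖ ^ 2 := integral_norm_sq y.1.1
    simp only [Pi.add_apply] at h'
    rw [← h, integral_add hdd hyy, e1, e2, real_inner_self_eq_norm_sq,
      real_inner_self_eq_norm_sq] at h'
    have := pow_le_pow_left₀ (norm_nonneg _) n1 2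
    have := pow_le_pow_left₀ (norm_nonneg _) n2 2
    linarith [(abs_le.1 h').2]
  have hci : Integrable (fun s => ‖pointValue y s‖ ^ 2) (timeMeasure T) :=
    (hrep.1.norm.pow 2).integrableOn_Icc.mono_set Ioo_subset_Icc_self
  have hm1 : ∫ _, ‖pointValue y t‖ ^ 2 ∂timeMeasure T ≤
      ∫ s, (‖pointValue y s‖ ^ 2 + 2 * ‖y‖ ^ 2) ∂timeMeasure T := by
    refine integral_mono_ae (integrable_const _) (hci.add (integrable_const _)) ?_
    filter_upwards [ae_restrict_mem measurableSet_Ioo] with s hs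
    exact hstep s (Ioo_subset_Icc_self hs)
  have hm2 : ∫ s, ‖pointValue y s‖ ^ 2 ∂timeMeasure T ≤
      ∫ s, ‖ι‖ ^ 2 * ‖val y s‖ ^ 2 ∂timeMeasure T := by
    refine integral_mono_ae hci (hyy.const_mul _) ?_
    filter_upwards [hrep.2] with s hs
    simp only [hs]
    rw [← mul_pow]
    gcongr
    exact ι.le_opNorm _
  have e2 : ∫ x, ‖val y x‖ ^ 2 ∂timeMeasure T = ‖y.1.1‖ ^ 2 := integral_norm_sq y.1.1
  rw [integral_const_timeMeasure hT, integral_add hci (integrable_const _),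
    integral_const_timeMeasure hT] at hm1
  rw [integral_const_mul, e2] at hm2
  have h3 : ‖ι‖ ^ 2 * ‖y.1.1‖ ^ 2 ≤ ‖ι‖ ^ 2 * ‖y‖ ^ 2 := by gcongr
  linarith

/-- The continuous linear map `y ↦ y(t)` from `W(0,T)` to `H`. -/
def trace (hT : 0 < T) (hι : Function.Injective ι) {t : ℝ} (ht : t ∈ Icc 0 T) :
    stateSpace T ι →L[ℝ] H :=
  LinearMap.mkContinuous
    { toFun := fun y => pointValue y t
      map_add' := fun y z => ((isContinuousRep_pointValue hT hι y).add
        (isContinuousRep_pointValue hT hι z)).pointValue_eq hT hι ht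
      map_smul' := fun k y =>
        ((isContinuousRep_pointValue hT hι y).smul k).pointValue_eq hT hι ht }
    √((‖ι‖ ^ 2 + 2 * T) / T) fun y => by
      have h := mul_norm_pointValue_sq_le hT hι y ht
      refine (sq_le_sq₀ (norm_nonneg _) (by positivity)).1 ?_
      rw [mul_pow, Real.sq_sqrt (by positivity), div_mul_eq_mul_div, le_div_iff₀ hT, mul_comm]
      exact h

theorem trace_apply (hT : 0 < T) (hι : Function.Injective ι) {t : ℝ} (ht : t ∈ Icc 0 T)
    (y : stateSpace T ι) : trace hT hι ht y = pointValue y t := rfl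

/-- A closed linear condition that holds almost everywhere holds for all point values. -/
theorem map_pointValue_eq_zero (hT : 0 < T) (hι : Function.Injective ι) {y : stateSpace T ι}
    (L : H →L[ℝ] H) (h : ∀ᵐ t ∂timeMeasure T, L (ι (val y t)) = 0) {t : ℝ} (ht : t ∈ Icc 0 T) :
    L (pointValue y t) = 0 := by
  have hrep := isContinuousRep_pointValue hT hι y
  have hae : (fun s => L (pointValue y s)) =ᵐ[volume.restrict (Icc 0 T)] fun _ => (0 : H) := by
    rw [← restrict_Ioo_eq_restrict_Icc]
    filter_upwards [h, hrep.2] with s h1 h2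
    rw [h2, h1]
  exact Measure.eqOn_Icc_of_ae_eq volume hT.ne hae (L.continuous.comp_continuousOn hrep.1)
    continuousOn_const ht

end Trace

/-! ### Multiplication by bounded operator functions and the duality pairing. -/

section Multiplication

variable {T : ℝ} {E F : Type*} [NormedAddCommGroup E] [NormedSpace ℝ E]
  [NormedAddCommGroup F] [NormedSpace ℝ F]

/-- The operator `L²(0,T;E) → L²(0,T;F)` of multiplication by `A ∈ L^∞(0,T;L(E,F))`. -/
def mulOp {A : ℝ → E →L[ℝ] F} (hA : MemLp A ∞ (timeMeasure T)) :
    Lp E 2 (timeMeasure T) →L[ℝ] Lp F 2 (timeMeasure T) :=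
  (ContinuousLinearMap.id ℝ (E →L[ℝ] F)).holderL (timeMeasure T) ∞ 2 2 hA.toLp

theorem coeFn_mulOp {A : ℝ → E →L[ℝ] F} (hA : MemLp A ∞ (timeMeasure T))
    (f : Lp E 2 (timeMeasure T)) : ∀ᵐ t ∂timeMeasure T, mulOp hA f t = A t (f t) := by
  filter_upwards [(ContinuousLinearMap.id ℝ (E →L[ℝ] F)).coeFn_holder (r := 2) hA.toLp f,
    hA.coeFn_toLp] with t h1 h2
  rw [mulOp, ContinuousLinearMap.holderL_apply_apply, h1, h2]
  rfl

/-- The duality pairing of `L²(0,T;V')` and `L²(0,T;V)`. -/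
def dualPairing (T : ℝ) (V : Type*) [NormedAddCommGroup V] [NormedSpace ℝ V] :
    Lp (StrongDual ℝ V) 2 (timeMeasure T) →L[ℝ] Lp V 2 (timeMeasure T) →L[ℝ] ℝ :=
  (ContinuousLinearMap.id ℝ (StrongDual ℝ V)).lpPairing (timeMeasure T) 2 2

theorem dualPairing_apply (f : Lp (StrongDual ℝ E) 2 (timeMeasure T))
    (g : Lp E 2 (timeMeasure T)) : dualPairing T E f g = ∫ t, f t (g t) ∂timeMeasure T :=
  ContinuousLinearMap.lpPairing_eq_integral _ f g

end Multiplication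

/-! ### Existence for the parabolic equation by Lions' lemma. -/

section Existence

/-- Lions' projection lemma. -/
theorem exists_inner_eq_of_coercive {X Φ : Type*} [NormedAddCommGroup X] [InnerProductSpace ℝ X]
    [CompleteSpace X] [AddCommGroup Φ] [Module ℝ Φ] (M N : Φ →ₗ[ℝ] X) {η : ℝ} (hη : 0 < η)
    (h : ∀ φ, η * ‖N φ‖ ^ 2 ≤ ⟪M φ, N φ⟫_ℝ) (F : X →L[ℝ] ℝ) :
    ∃ y : X, ∀ φ, ⟪y, M φ⟫_ℝ = F (N φ) := by
  have hle : ∀ φ, ‖N φ‖ ≤ η⁻¹ * ‖M φ‖ := fun φ => by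
    rw [inv_mul_eq_div, le_div_iff₀ hη]
    rcases (norm_nonneg (N φ)).eq_or_lt with h0 | h0
    · rw [← h0, zero_mul]
      exact norm_nonneg _
    · refine le_of_mul_le_mul_right ?_ h0
      calc ‖N φ‖ * η * ‖N φ‖ = η * ‖N φ‖ ^ 2 := by ring
        _ ≤ ⟪M φ, N φ⟫_ℝ := h φ
        _ ≤ ‖M φ‖ * ‖N φ‖ := real_inner_le_norm _ _
  obtain ⟨g, hg⟩ := M.rangeRestrict.exists_rightInverse_of_surjective
    (LinearMap.range_eq_top.2 M.surjective_rangeRestrict)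
  have hg' : ∀ m : LinearMap.range M, M (g m) = m := fun m =>
    congrArg Subtype.val (LinearMap.congr_fun hg m)
  -- The estimate `hle` makes `M φ ↦ F (N φ)` a bounded functional on the range of `M`, ready for
  -- Hahn–Banach.
  let l : LinearMap.range M →L[ℝ] ℝ := LinearMap.mkContinuous
    ((F : X →ₗ[ℝ] ℝ).comp (N.comp g)) (‖F‖ * η⁻¹) fun m => by
      refine (F.le_opNorm _).trans ?_
      rw [mul_assoc]
      gcongr
      have := hle (g m)
      rwa [hg'] at this
  obtain ⟨k, hk, -⟩ := exists_extension_norm_eq (LinearMap.range M) l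
  refine ⟨(InnerProductSpace.toDual ℝ X).symm k, fun φ => ?_⟩
  rw [InnerProductSpace.toDual_symm_apply]
  have h1 : k (M φ) = F (N (g ⟨M φ, φ, rfl⟩)) := hk ⟨M φ, φ, rfl⟩
  have h2 : N (g ⟨M φ, φ, rfl⟩) = N φ := by
    have h3 := hle (g ⟨M φ, φ, rfl⟩ - φ)
    rw [map_sub, map_sub, hg', sub_self, norm_zero, mul_zero] at h3
    exact sub_eq_zero.1 (norm_le_zero_iff.1 h3)
  rw [h1, h2]

variable {V H : Type*}
  [NormedAddCommGroup V] [InnerProductSpace ℝ V] [CompleteSpace V]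
  [NormedAddCommGroup H] [InnerProductSpace ℝ H] [CompleteSpace H]
  {T : ℝ} {ι : V →L[ℝ] H}

/-- Existence for the weak formulation of the parabolic equation with zero initial value. -/
theorem exists_weak_solution (hT : 0 < T) (hι : Function.Injective ι)
    {A : ℝ → V →L[ℝ] StrongDual ℝ V} (hA : MemLp A ∞ (timeMeasure T)) {η : ℝ} (hη : 0 < η)
    (hc : ∀ᵐ t ∂timeMeasure T, ∀ v : V, η * ‖v‖ ^ 2 ≤ A t v v)
    (f : Lp (StrongDual ℝ V) 2 (timeMeasure T)) :
    ∃ y : Lp V 2 (timeMeasure T), ∀ φ : stateSpace T ι, pointValue φ T = 0 →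
      ∫ t, (A t (y t) (val φ t) - timeDeriv φ t (y t)) ∂timeMeasure T =
        ∫ t, f t (val φ t) ∂timeMeasure T := by
  have hTm : T ∈ Icc 0 T := right_mem_Icc.2 hT.le
  have hAf : MemLp (fun t => (A t).flip) ∞ (timeMeasure T) :=
    MemLp.of_le (E := V →L[ℝ] V →L[ℝ] ℝ) (F := V →L[ℝ] V →L[ℝ] ℝ) hA
      ((ContinuousLinearMap.flipₗᵢ ℝ V V ℝ).continuous.comp_aestronglyMeasurable hA.1)
      (.of_forall fun t => (ContinuousLinearMap.opNorm_flip _).le)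
  -- The test functions vanish at `T`. For them `-∫ ∂ₜφ(φ)` equals `½ ‖φ(0)‖²`, which is
  -- nonnegative, so coercivity of `A` makes `φ ↦ A' φ - ∂ₜφ` coercive in the norm of `L²(0,T;V)`.
  let Φ := (trace hT hι hTm).ker
  let N₀ : stateSpace T ι →ₗ[ℝ] Lp V 2 (timeMeasure T) :=
    (LinearMap.fst ℝ _ _).comp (stateSpace T ι).subtype
  let D₀ : stateSpace T ι →ₗ[ℝ] Lp (StrongDual ℝ V) 2 (timeMeasure T) :=
    (LinearMap.snd ℝ _ _).comp (stateSpace T ι).subtype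
  let M₀ : stateSpace T ι →ₗ[ℝ] Lp V 2 (timeMeasure T) :=
    ((rieszRep V).compLpL 2 (timeMeasure T) : _ →ₗ[ℝ] _).comp
      (((mulOp hAf : _ →ₗ[ℝ] _).comp N₀) - D₀)
  have hM : ∀ (φ : stateSpace T ι), ∀ᵐ t ∂timeMeasure T, ∀ v : V,
      ⟪v, M₀ φ t⟫_ℝ = A t v (val φ t) - timeDeriv φ t v := by
    intro φ
    filter_upwards [(rieszRep V).coeFn_compLpL (p := 2) (mulOp hAf φ.1.1 - φ.1.2),
      Lp.coeFn_sub (mulOp hAf φ.1.1) φ.1.2, coeFn_mulOp hAf φ.1.1] with t h1 h2 h3 v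
    have : M₀ φ t = rieszRep V ((mulOp hAf φ.1.1 - φ.1.2 : Lp _ 2 (timeMeasure T)) t) := h1
    rw [this, real_inner_comm, inner_rieszRep, h2, Pi.sub_apply, h3]
    rfl
  obtain ⟨y, hy⟩ := exists_inner_eq_of_coercive (Φ := Φ) (M₀.comp Φ.subtype) (N₀.comp Φ.subtype) hη
    (fun φ => by
      have hφT : pointValue φ.1 T = 0 := φ.2
      have hib := integral_timeDeriv_add hT hι φ.1 φ.1
      have hid : Integrable (fun t => timeDeriv φ.1 t (val φ.1 t)) (timeMeasure T) :=
        integrable_dual_apply (memLp_timeDeriv φ.1) (memLp_val φ.1)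
      rw [hφT, inner_zero_left, zero_sub, integral_add hid hid,
        real_inner_self_eq_norm_sq] at hib
      have hyy : Integrable (fun x => ‖val φ.1 x‖ ^ 2) (timeMeasure T) := by
        simpa only [sq] using integrable_norm_mul_norm (memLp_val φ.1) (memLp_val φ.1)
      have hin : ⟪M₀ φ.1, N₀ φ.1⟫_ℝ = ∫ t, ⟪M₀ φ.1 t, val φ.1 t⟫_ℝ ∂timeMeasure T :=
        L2.inner_def _ _
      have hii : Integrable (fun t => ⟪M₀ φ.1 t, val φ.1 t⟫_ℝ) (timeMeasure T) :=
        integrable_inner (Lp.memLp _) (memLp_val φ.1)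
      change η * ‖φ.1.1.1‖ ^ 2 ≤ ⟪M₀ φ.1, N₀ φ.1⟫_ℝ
      rw [hin, ← integral_norm_sq, ← integral_const_mul]
      have hmono : ∫ t, (η * ‖val φ.1 t‖ ^ 2 - timeDeriv φ.1 t (val φ.1 t)) ∂timeMeasure T ≤
          ∫ t, ⟪M₀ φ.1 t, val φ.1 t⟫_ℝ ∂timeMeasure T := by
        refine integral_mono_ae ((hyy.const_mul η).sub hid) hii ?_
        filter_upwards [hM φ.1, hc] with t h1 h2
        rw [real_inner_comm, h1]
        linarith [h2 (val φ.1 t)]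
      rw [integral_sub (hyy.const_mul η) hid] at hmono
      refine le_trans ?_ hmono
      change ∫ t, η * ‖val φ.1 t‖ ^ 2 ∂timeMeasure T ≤ _
      linarith [sq_nonneg ‖pointValue φ.1 0‖]) (dualPairing T V f)
  refine ⟨y, fun φ hφ => ?_⟩
  have h1 : ⟪y, M₀ φ⟫_ℝ = dualPairing T V f φ.1.1 := hy ⟨φ, hφ⟩
  rw [dualPairing_apply, L2.inner_def] at h1
  rw [← show ∫ t, f t (φ.1.1 t) ∂timeMeasure T = ∫ t, f t (val φ t) ∂timeMeasure T from rfl, ← h1]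
  apply integral_congr_ae
  filter_upwards [hM φ] with t ht
  rw [ht]

/-- Existence of solutions in `W(0,T)` of the parabolic equation with zero initial value. -/
theorem exists_solution (hT : 0 < T) (hι : Function.Injective ι)
    {A : ℝ → V →L[ℝ] StrongDual ℝ V} (hA : MemLp A ∞ (timeMeasure T)) {η : ℝ} (hη : 0 < η)
    (hc : ∀ᵐ t ∂timeMeasure T, ∀ v : V, η * ‖v‖ ^ 2 ≤ A t v v)
    (f : Lp (StrongDual ℝ V) 2 (timeMeasure T)) :
    ∃ y : stateSpace T ι, (∀ᵐ t ∂timeMeasure T, timeDeriv y t + A t (val y t) = f t) ∧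
      pointValue y 0 = 0 := by
  obtain ⟨z, hz⟩ := exists_weak_solution (ι := ι) hT hι hA hη hc f
  have h0m : (0 : ℝ) ∈ Icc 0 T := left_mem_Icc.2 hT.le
  have hTm : T ∈ Icc 0 T := right_mem_Icc.2 hT.le
  have hzm : MemLp z 2 (timeMeasure T) := Lp.memLp z
  have hAz : MemLp (fun t => A t (z t)) 2 (timeMeasure T) :=
    (memLp_congr_ae (coeFn_mulOp hA z)).1 (Lp.memLp _)
  have hg : MemLp (fun t => f t - A t (z t)) 2 (timeMeasure T) := (Lp.memLp f).sub hAz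
  -- Here `ψ` need not vanish at `0`. Compactly supported `ψ` identify the weak derivative; the
  -- others recover the initial value.
  have htest : ∀ {ψ : ℝ → ℝ}, ContDiff ℝ 1 ψ → ψ T = 0 → ∀ v : V,
      ∫ t, deriv ψ t • toDualOf ι (z t) v ∂timeMeasure T =
        - ∫ t, ψ t • (f t - A t (z t)) v ∂timeMeasure T := by
    intro ψ hψ hψT v
    obtain ⟨w, hw, hw', hwc⟩ := exists_stateSpace_smul (ι := ι) hT hψ v
    have h := hz w (by rw [hwc.pointValue_eq hT hι hTm, hψT, zero_smul])
    have hi1 := integrable_dual_apply hAz (memLp_val w)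
    have hi2 := integrable_dual_apply (memLp_timeDeriv w) hzm
    have hi3 := integrable_dual_apply (Lp.memLp f) (memLp_val w)
    rw [integral_sub hi1 hi2] at h
    have e1 : ∫ t, deriv ψ t • toDualOf ι (z t) v ∂timeMeasure T =
        ∫ t, timeDeriv w t (z t) ∂timeMeasure T := by
      apply integral_congr_ae
      filter_upwards [hw'] with t ht
      rw [ht, smul_apply]
      congr 1
      exact real_inner_comm _ _
    have e2 : ∫ t, ψ t • (f t - A t (z t)) v ∂timeMeasure T =
        (∫ t, f t (val w t) ∂timeMeasure T) - ∫ t, A t (z t) (val w t) ∂timeMeasure T := by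
      rw [← integral_sub hi3 hi1]
      apply integral_congr_ae
      filter_upwards [hw] with t ht
      rw [ht, map_smul, map_smul, ← smul_sub, sub_apply]
    rw [e1, e2]
    linarith
  obtain ⟨y, hy, hy'⟩ := exists_stateSpace (ι := ι) hzm hg (fun φ h1 h2 h3 => by
    ext v
    have hi1 := integrable_test_smul (h1.continuous_deriv (by norm_num)) h2.deriv
      (memLp_toDualOf ι hzm)
    have hi2 := integrable_test_smul h1.continuous h2 hg
    rw [neg_apply, ContinuousLinearMap.integral_apply hi1,
      ContinuousLinearMap.integral_apply hi2]
    exact htest (h1.of_le (by norm_num)) (eq_zero_of_notMem_tsupport h3 (by simp)) v)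
  refine ⟨y, ?_, ?_⟩
  · filter_upwards [hy, hy'] with t h1 h2
    rw [h1, h2, sub_add_cancel]
  have horth : ∀ v : V, ⟪pointValue y 0, ι v⟫_ℝ = 0 := by
    intro v
    -- This function is `1` at `0` and `0` at `T`, so integration by parts isolates the initial
    -- value.
    have hψ : ContDiff ℝ 1 (fun t : ℝ => 1 - t / T) := by fun_prop
    obtain ⟨w, hw, hw', hwc⟩ := exists_stateSpace_smul (ι := ι) hT hψ v
    have hib := integral_timeDeriv_add hT hι y w
    rw [hwc.pointValue_eq hT hι hTm, hwc.pointValue_eq hT hι h0m] at hib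
    simp only [div_self hT.ne', sub_self, zero_smul, inner_zero_right, zero_div, sub_zero, one_smul,
      zero_sub] at hib
    have h := htest hψ (by simp [hT.ne']) v
    have e1 : ∫ t, timeDeriv w t (val y t) ∂timeMeasure T =
        ∫ t, deriv (fun t : ℝ => 1 - t / T) t • toDualOf ι (z t) v ∂timeMeasure T := by
      apply integral_congr_ae
      filter_upwards [hw', hy] with t h1 h2
      rw [h1, h2, smul_apply]
      congr 1
      exact real_inner_comm _ _
    have e2 : ∫ t, timeDeriv y t (val w t) ∂timeMeasure T =
        ∫ t, (1 - t / T) • (f t - A t (z t)) v ∂timeMeasure T := by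
      apply integral_congr_ae
      filter_upwards [hw, hy'] with t h1 h2
      rw [h1, h2, map_smul]
    rw [integral_add (integrable_dual_apply (memLp_timeDeriv y) (memLp_val w))
      (integrable_dual_apply (memLp_timeDeriv w) (memLp_val y)), e1, e2, h] at hib
    linarith
  -- By continuity `y(0)` lies in the closure of the range of `ι`; it is also orthogonal to that
  -- range, hence zero.
  let R : Submodule ℝ H := (LinearMap.range (ι : V →ₗ[ℝ] H)).topologicalClosure
  have hproj := map_pointValue_eq_zero hT hι (y := y)
    (ContinuousLinearMap.id ℝ H - R.starProjection) (.of_forall fun t => by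
      have : ι (val y t) ∈ R := Submodule.le_topologicalClosure _ ⟨val y t, rfl⟩
      simp [Submodule.starProjection_eq_self_iff.2 this]) h0m
  have hmem : pointValue y 0 ∈ R := by
    rw [← Submodule.starProjection_eq_self_iff]
    exact (sub_eq_zero.1 hproj).symm
  have hperp : pointValue y 0 ∈ Rᗮ := by
    rw [Submodule.orthogonal_closure, Submodule.mem_orthogonal']
    rintro _ ⟨v, rfl⟩
    exact horth v
  exact inner_self_eq_zero.1 ((Submodule.mem_orthogonal _ _).1 hperp _ hmem)

end Existence

theorem memLp_comp_comp {T : ℝ} {E E' F F' : Type*}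
    [NormedAddCommGroup E] [NormedSpace ℝ E] [NormedAddCommGroup E'] [NormedSpace ℝ E']
    [NormedAddCommGroup F] [NormedSpace ℝ F] [NormedAddCommGroup F'] [NormedSpace ℝ F']
    {A : ℝ → E →L[ℝ] F} (hA : MemLp A ∞ (timeMeasure T)) (R : F →L[ℝ] F') (S : E' →L[ℝ] E) :
    MemLp (fun t => (R.comp (A t)).comp S) ∞ (timeMeasure T) := by
  have hc : Continuous fun B : E →L[ℝ] F => (R.comp B).comp S := by fun_prop
  refine MemLp.of_le_mul (c := ‖R‖ * ‖S‖) hA (hc.comp_aestronglyMeasurable hA.1)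
    (.of_forall fun t => ?_)
  calc ‖(R.comp (A t)).comp S‖ ≤ ‖R.comp (A t)‖ * ‖S‖ := ContinuousLinearMap.opNorm_comp_le _ _
    _ ≤ ‖R‖ * ‖A t‖ * ‖S‖ := by gcongr; exact ContinuousLinearMap.opNorm_comp_le _ _
    _ = _ := by ring

/-! ### Galerkin solutions and their lift to `W(0,T)`. -/

section Reduced

variable {V H U : Type*}
  [NormedAddCommGroup V] [InnerProductSpace ℝ V]
  [NormedAddCommGroup H] [InnerProductSpace ℝ H]
  [NormedAddCommGroup U] [InnerProductSpace ℝ U]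
  {T : ℝ} {ι : V →L[ℝ] H}

/-- The projection of `V` onto a finite-dimensional subspace that is orthogonal in `H`. -/
theorem exists_projection_inner_eq (hι : Function.Injective ι) (W : Submodule ℝ V)
    [FiniteDimensional ℝ W] :
    ∃ P : V →L[ℝ] W, (∀ v : V, ∀ w : W, ⟪ι w, ι (P v)⟫_ℝ = ⟪ι w, ι v⟫_ℝ) ∧ ∀ w : W, P w = w := by
  have : FiniteDimensional ℝ (W.map (ι : V →ₗ[ℝ] H)) := inferInstance
  let e : W ≃ₗ[ℝ] W.map (ι : V →ₗ[ℝ] H) := Submodule.equivMapOfInjective (ι : V →ₗ[ℝ] H) hι W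
  have he : ∀ x, ι (e.symm x) = x := fun x => by
    have : ((e (e.symm x) : W.map (ι : V →ₗ[ℝ] H)) : H) = ι (e.symm x) := rfl
    rw [← this, e.apply_symm_apply]
  -- Project in `H` onto the image of `W`, then pull back along `ι`; the pullback is continuous by
  -- finite dimension.
  let P : V →L[ℝ] W := ((e.symm : _ →ₗ[ℝ] W).toContinuousLinearMap).comp
    ((W.map (ι : V →ₗ[ℝ] H)).orthogonalProjectionOnto.comp ι)
  have hP : ∀ v : V, ι (P v) = (W.map (ι : V →ₗ[ℝ] H)).starProjection (ι v) := fun v => he _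
  refine ⟨P, fun v w => ?_, fun w => Subtype.ext (hι ?_)⟩
  · have hw : (W.map (ι : V →ₗ[ℝ] H)).starProjection (ι w) = ι w :=
      Submodule.starProjection_eq_self_iff.2 ⟨w, w.2, rfl⟩
    rw [hP, ← Submodule.inner_starProjection_left_eq_right, hw]
  · rw [hP, Submodule.starProjection_eq_self_iff]
    exact ⟨w, w.2, rfl⟩

variable [CompleteSpace H]

/-- Existence of Galerkin solutions in an isometrically embedded Hilbert space. -/
theorem exists_galerkin_solution (hT : 0 < T) (hι : Function.Injective ι) (D : Data T V H U)
    {E : Type*} [NormedAddCommGroup E] [InnerProductSpace ℝ E] [CompleteSpace E] (j : E →L[ℝ] V)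
    (hj : ∀ x, ‖j x‖ = ‖x‖) (f : Lp (StrongDual ℝ V) 2 (timeMeasure T)) :
    ∃ z : stateSpace T (ι.comp j),
      (∀ᵐ t ∂timeMeasure T, ∀ w, timeDeriv z t w + D.A t (j (val z t)) (j w) = f t (j w)) ∧
      pointValue z 0 = 0 := by
  obtain ⟨η, hη, hc⟩ := D.A_coercive
  let R : StrongDual ℝ V →L[ℝ] StrongDual ℝ E := (ContinuousLinearMap.compL ℝ E V ℝ).flip j
  have hf : MemLp (fun t => R (f t)) 2 (timeMeasure T) := R.comp_memLp' (Lp.memLp f)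
  have hji : Function.Injective j := (injective_iff_map_eq_zero j).2 fun x hx => by
    rw [← norm_eq_zero, ← hj, hx, norm_zero]
  obtain ⟨z, hz, hz0⟩ := exists_solution (ι := ι.comp j) hT (hι.comp hji)
    (memLp_comp_comp D.A_memLp R j) hη (by
      filter_upwards [hc] with t ht x
      rw [← hj]
      exact ht (j x)) hf.toLp
  refine ⟨z, ?_, hz0⟩
  filter_upwards [hz, hf.coeFn_toLp] with t h1 h2 w
  exact DFunLike.congr_fun (h1.trans h2) w

variable [CompleteSpace V]

/-- Extension of an element of `W(0,T)` over a finite-dimensional subspace of `V`. -/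
theorem exists_stateSpace_extension (hT : 0 < T) (hι : Function.Injective ι) (W : Submodule ℝ V)
    [FiniteDimensional ℝ W] (z : stateSpace T (ι.comp W.subtypeL)) :
    ∃ y : stateSpace T ι, (∀ᵐ t ∂timeMeasure T, val y t = val z t) ∧
      (∀ᵐ t ∂timeMeasure T, ∀ w : W, timeDeriv y t w = timeDeriv z t w) ∧
      ∀ t ∈ Icc 0 T, pointValue y t = pointValue z t := by
  obtain ⟨P, hP, hPw⟩ := exists_projection_inner_eq hι W
  -- Functionals on `W` are extended by composition with `P`. Orthogonality in `H` makes this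
  -- extension compatible with the embeddings of `W` into `W'` and into `V'`, so weak derivatives go
  -- to weak derivatives.
  let E : StrongDual ℝ W →L[ℝ] StrongDual ℝ V := (ContinuousLinearMap.compL ℝ V W ℝ).flip P
  have hE : ∀ x : W, toDualOf ι (x : V) = E (toDualOf (ι.comp W.subtypeL) x) := fun x => by
    ext v
    exact (hP v x).symm
  obtain ⟨y, hy, hy'⟩ := exists_stateSpace (ι := ι) (W.subtypeL.comp_memLp' (memLp_val z))
    (E.comp_memLp' (memLp_timeDeriv z)) (fun φ h1 h2 h3 => by
      have h := congrArg E (z.2 φ h1 h2 h3)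
      change E (∫ t, deriv φ t • toDualOf (ι.comp W.subtypeL) (val z t) ∂timeMeasure T) =
        E (-∫ t, φ t • timeDeriv z t ∂timeMeasure T) at h
      rw [map_neg, ← E.integral_comp_comm (integrable_test_smul
          (h1.continuous_deriv (by norm_num)) h2.deriv (memLp_toDualOf _ (memLp_val z))),
        ← E.integral_comp_comm (integrable_test_smul h1.continuous h2 (memLp_timeDeriv z))] at h
      simp only [map_smul, ← hE] at h
      exact h)
  have hιW : Function.Injective (ι.comp W.subtypeL) := hι.comp Subtype.val_injective
  have hrep := isContinuousRep_pointValue hT hιW z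
  have hrep' : IsContinuousRep y (pointValue z) := by
    refine ⟨hrep.1, ?_⟩
    filter_upwards [hrep.2, hy] with t h1 h2
    rw [h1, h2]
    rfl
  refine ⟨y, hy, ?_, fun t ht => hrep'.pointValue_eq hT hι ht⟩
  filter_upwards [hy'] with t h1 w
  rw [h1]
  exact congrArg (timeDeriv z t) (hPw w)

/-- Existence of solutions of the reduced parabolic equation with zero initial value. -/
theorem exists_reduced_solution (hT : 0 < T) (hι : Function.Injective ι) (D : Data T V H U)
    (W : Submodule ℝ V) [FiniteDimensional ℝ W] (f : Lp (StrongDual ℝ V) 2 (timeMeasure T)) :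
    ∃ y : stateSpace T ι, IsReducedState W y ∧
      (∀ᵐ t ∂timeMeasure T, ∀ w ∈ W, timeDeriv y t w + D.A t (val y t) w = f t w) ∧
      pointValue y 0 = 0 := by
  obtain ⟨z, hz, hz0⟩ := exists_galerkin_solution hT hι D W.subtypeL (fun _ => rfl) f
  obtain ⟨y, hy, hy', hy0⟩ := exists_stateSpace_extension hT hι W z
  refine ⟨y, ?_, ?_, ?_⟩
  · filter_upwards [hy] with t ht
    rw [ht]
    exact (val z t).2
  · filter_upwards [hy, hy', hz] with t h1 h2 h3 w hw
    rw [h1, h2 ⟨w, hw⟩]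
    exact h3 ⟨w, hw⟩
  · rw [hy0 0 (left_mem_Icc.2 hT.le), hz0]

end Reduced

/-! ### Cost and Lagrangian in terms of bounded operators. -/

section Operators

variable {V H U : Type*}
  [NormedAddCommGroup V] [InnerProductSpace ℝ V]
  [NormedAddCommGroup H] [InnerProductSpace ℝ H]
  [NormedAddCommGroup U] [InnerProductSpace ℝ U]
  {T : ℝ}

variable (T) in
/-- The embedding of `W(0,T)` into `L²(0,T;V)`. -/
def toLp (ι : V →L[ℝ] H) : stateSpace T ι →L[ℝ] Lp V 2 (timeMeasure T) :=
  (ContinuousLinearMap.fst ℝ _ _).comp (stateSpace T ι).subtypeL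

variable {ι : V →L[ℝ] H} (D : Data T V H U)

theorem toLp_apply (y : stateSpace T ι) (t : ℝ) : toLp T ι y t = val y t := rfl

variable (ι) in
/-- The observation operator `y ↦ C y` from `W(0,T)` to `L²(0,T;H)`. -/
def obs : stateSpace T ι →L[ℝ] Lp H 2 (timeMeasure T) :=
  (mulOp D.C_memLp).comp ((ι.compLpL 2 (timeMeasure T)).comp (toLp T ι))

theorem coeFn_obs (y : stateSpace T ι) :
    ∀ᵐ t ∂timeMeasure T, obs ι D y t = D.C t (ι (val y t)) := by
  filter_upwards [coeFn_mulOp D.C_memLp (ι.compLp (toLp T ι y)), ι.coeFn_compLp (toLp T ι y)]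
    with t h1 h2
  rw [toLp_apply] at h2
  rw [← h2, ← h1]
  rfl

variable (ι) in
/-- The parabolic operator `y ↦ ∂ₜy + A y` from `W(0,T)` to `L²(0,T;V')`. -/
def stateOp : stateSpace T ι →L[ℝ] Lp (StrongDual ℝ V) 2 (timeMeasure T) :=
  (ContinuousLinearMap.snd ℝ _ _).comp (stateSpace T ι).subtypeL +
    (mulOp D.A_memLp).comp (toLp T ι)

theorem coeFn_stateOp (y : stateSpace T ι) :
    ∀ᵐ t ∂timeMeasure T, stateOp ι D y t = timeDeriv y t + D.A t (val y t) := by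
  filter_upwards [coeFn_mulOp D.A_memLp (toLp T ι y), Lp.coeFn_add y.1.2
    (mulOp D.A_memLp (toLp T ι y))] with t h1 h2
  rw [toLp_apply] at h1
  rw [Pi.add_apply, h1] at h2
  exact h2

/-- The control operator `u ↦ B u` from `L²(0,T;U)` to `L²(0,T;V')`. -/
def controlOp : Lp U 2 (timeMeasure T) →L[ℝ] Lp (StrongDual ℝ V) 2 (timeMeasure T) :=
  D.B.compLpL 2 (timeMeasure T)

theorem coeFn_controlOp (u : Lp U 2 (timeMeasure T)) :
    ∀ᵐ t ∂timeMeasure T, controlOp D u t = D.B (u t) :=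
  D.B.coeFn_compLp u

theorem integrable_norm_sq {E : Type*} [NormedAddCommGroup E] (f : Lp E 2 (timeMeasure T)) :
    Integrable (fun t => ‖f t‖ ^ 2) (timeMeasure T) := by
  simpa only [sq] using integrable_norm_mul_norm (Lp.memLp f) (Lp.memLp f)

theorem coeFn_obs_sub (y : stateSpace T ι) :
    ∀ᵐ t ∂timeMeasure T, (obs ι D y - D.yd) t = D.C t (ι (val y t)) - D.yd t := by
  filter_upwards [coeFn_obs D y, Lp.coeFn_sub (obs ι D y) D.yd] with t h1 h2
  rw [h2, Pi.sub_apply, h1]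

theorem integral_tracking (y : stateSpace T ι) :
    ∫ t, ‖D.C t (ι (val y t)) - D.yd t‖ ^ 2 ∂timeMeasure T = ‖obs ι D y - D.yd‖ ^ 2 := by
  rw [← integral_norm_sq]
  apply integral_congr_ae
  filter_upwards [coeFn_obs_sub D y] with t ht
  rw [ht]

theorem cost_eq (y : stateSpace T ι) (u : Lp U 2 (timeMeasure T)) :
    cost D y u = 1 / 2 * ‖obs ι D y - D.yd‖ ^ 2 + D.β / 2 * ‖u‖ ^ 2 := by
  rw [← integral_norm_sq, ← integral_norm_sq, ← integral_const_mul, ← integral_const_mul,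
    ← integral_add ((integrable_norm_sq _).const_mul _) ((integrable_norm_sq _).const_mul _)]
  apply integral_congr_ae
  filter_upwards [coeFn_obs_sub D y] with t ht
  rw [ht]

theorem lagrangian_eq (y : stateSpace T ι) (u : Lp U 2 (timeMeasure T)) (p : stateSpace T ι) :
    lagrangian D y u p = 1 / 2 * ‖obs ι D y - D.yd‖ ^ 2 + D.β / 2 * ‖u‖ ^ 2 +
      dualPairing T V (controlOp D u - stateOp ι D y) (toLp T ι p) +
      ⟪D.y0 - pointValue y 0, pointValue p 0⟫_ℝ := by
  rw [lagrangian, integral_tracking, dualPairing_apply]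
  congr 2
  apply integral_congr_ae
  filter_upwards [coeFn_controlOp D u, coeFn_stateOp D y,
    Lp.coeFn_sub (controlOp D u) (stateOp ι D y)] with t h1 h2 h3
  rw [h3, Pi.sub_apply, h1, h2, toLp_apply, sub_add_eq_sub_sub]

/-- The operator `𝒥_U⁻¹ B' : V → U`. -/
def dualControl [CompleteSpace U] : V →L[ℝ] U := (rieszRep U).comp D.B.flip

theorem inner_dualControl [CompleteSpace U] (w : V) (x : U) :
    ⟪dualControl D w, x⟫_ℝ = D.B x w :=
  inner_rieszRep _ _

theorem dualPairing_controlOp [CompleteSpace U] (u : Lp U 2 (timeMeasure T))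
    (p : Lp V 2 (timeMeasure T)) :
    dualPairing T V (controlOp D u) p = ⟪(dualControl D).compLp p, u⟫_ℝ := by
  rw [dualPairing_apply, L2.inner_def]
  apply integral_congr_ae
  filter_upwards [coeFn_controlOp D u, (dualControl D).coeFn_compLp p] with t h1 h2
  rw [h1, h2, inner_dualControl]

/-- The choice of `Uᵣ` enters the argument here: it makes the gradient of the reduced problem an
admissible variation. -/
theorem dualControl_mem [CompleteSpace U] {r : ℕ} (v : Fin r → V) {w : V} (hw : w ∈ redSpace v) :
    dualControl D w ∈ redControlSpace D v := by
  have : redSpace v ≤ (redControlSpace D v).comap (dualControl D : V →ₗ[ℝ] U) := by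
    refine Submodule.span_le.2 ?_
    rintro _ ⟨i, rfl⟩
    exact Submodule.subset_span ⟨i, rfl⟩
  exact this hw

theorem IsState.stateOp_eq {D : Data T V H U} {u : Lp U 2 (timeMeasure T)} {y : stateSpace T ι}
    (h : IsState D u y) : stateOp ι D y = controlOp D u := by
  refine Lp.ext ?_
  filter_upwards [h.1, coeFn_stateOp D y, coeFn_controlOp D u] with t h1 h2 h3
  rw [h2, h3, h1]

/-- The reduced state equation, tested with reduced functions. -/
theorem dualPairing_stateOp_eq {u : Lp U 2 (timeMeasure T)} {y p : stateSpace T ι} {r : ℕ}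
    {v : Fin r → V} (hp : IsReducedState (redSpace v) p)
    (h : ∀ᵐ t ∂timeMeasure T, ∀ w ∈ redSpace v,
      timeDeriv y t w + D.A t (val y t) w = D.B (u t) w) :
    dualPairing T V (stateOp ι D y) (toLp T ι p) =
      dualPairing T V (controlOp D u) (toLp T ι p) := by
  rw [dualPairing_apply, dualPairing_apply]
  apply integral_congr_ae
  filter_upwards [h, hp, coeFn_stateOp D y, coeFn_controlOp D u] with t h1 h2 h3 h4
  rw [h3, h4, toLp_apply, add_apply, h1 _ h2]

theorem coeFn_add_smul {E : Type*} [NormedAddCommGroup E] [NormedSpace ℝ E]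
    (f g : Lp E 2 (timeMeasure T)) (s : ℝ) :
    ∀ᵐ t ∂timeMeasure T, (f + s • g) t = f t + s • g t := by
  filter_upwards [Lp.coeFn_add f (s • g), Lp.coeFn_smul s g] with t h1 h2
  rw [h1, Pi.add_apply, h2, Pi.smul_apply]

theorem eq_zero_of_forall_quadratic_nonneg {L Q : ℝ} (hQ : 0 ≤ Q)
    (h : ∀ s : ℝ, 0 ≤ s * L + s ^ 2 * Q) : L = 0 := by
  -- The minimizer would be `-L / (2 Q)`; the denominator `1 + Q` also covers `Q = 0` and still
  -- gives a negative value unless `L = 0`.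
  have h1 := h (-L / (1 + Q))
  have hQ1 : 0 < 1 + Q := by linarith
  have h2 : -L / (1 + Q) * L + (-L / (1 + Q)) ^ 2 * Q = -(L / (1 + Q)) ^ 2 := by
    field_simp
    ring
  rw [h2] at h1
  have h3 : L / (1 + Q) = 0 :=
    pow_eq_zero_iff two_ne_zero |>.1 (by nlinarith [sq_nonneg (L / (1 + Q))])
  exact (div_eq_zero_iff.1 h3).resolve_right hQ1.ne'

/-- Vanishing of the directional derivative of the cost at a minimizer. -/
theorem inner_obs_add_eq_zero {y z : stateSpace T ι} {u w : Lp U 2 (timeMeasure T)}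
    (h : ∀ s : ℝ, cost D y u ≤ cost D (y + s • z) (u + s • w)) :
    ⟪obs ι D y - D.yd, obs ι D z⟫_ℝ + D.β * ⟪u, w⟫_ℝ = 0 := by
  have hβ := D.β_pos.le
  refine eq_zero_of_forall_quadratic_nonneg
    (Q := 1 / 2 * ‖obs ι D z‖ ^ 2 + D.β / 2 * ‖w‖ ^ 2) (by positivity) fun s => ?_
  have hs := h s
  have e : obs ι D y + s • obs ι D z - D.yd = (obs ι D y - D.yd) + s • obs ι D z := by abel
  rw [cost_eq, cost_eq, map_add, map_smul, e, norm_add_sq_real, norm_add_sq_real,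
    real_inner_smul_right, real_inner_smul_right, norm_smul, norm_smul, mul_pow, mul_pow,
    Real.norm_eq_abs, sq_abs] at hs
  linarith

end Operators

/-! ### Adjoint identities and first-order conditions. -/

section Optimality

variable {V H U : Type*}
  [NormedAddCommGroup V] [InnerProductSpace ℝ V] [CompleteSpace V]
  [NormedAddCommGroup H] [InnerProductSpace ℝ H] [CompleteSpace H]
  [NormedAddCommGroup U] [InnerProductSpace ℝ U]
  {T : ℝ} {ι : V →L[ℝ] H} {D : Data T V H U}
  {u : Lp U 2 (timeMeasure T)} {y p z : stateSpace T ι}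

/-- Integration by parts moves the time derivative from `p` to `z`; only the boundary term at `0`
remains. The adjoint equation is required only in the direction `z`, so the full and the reduced
adjoint are both covered. -/
theorem inner_obs_eq_of_adjoint (hT : 0 < T) (hι : Function.Injective ι)
    (h : ∀ᵐ t ∂timeMeasure T, - timeDeriv p t (val z t) + D.A t (val z t) (val p t)
      = ⟪D.C t (ι (val y t)) - D.yd t, D.C t (ι (val z t))⟫_ℝ) (hp : pointValue p T = 0) :
    ⟪obs ι D y - D.yd, obs ι D z⟫_ℝ =
      dualPairing T V (stateOp ι D z) (toLp T ι p) + ⟪pointValue z 0, pointValue p 0⟫_ℝ := by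
  have hib := integral_timeDeriv_add hT hι z p
  rw [hp, inner_zero_right, zero_sub] at hib
  have hi : Integrable (fun x => timeDeriv z x (val p x) + timeDeriv p x (val z x))
      (timeMeasure T) :=
    (integrable_dual_apply (memLp_timeDeriv z) (memLp_val p)).add
      (integrable_dual_apply (memLp_timeDeriv p) (memLp_val z))
  have hs : Integrable (fun t => stateOp ι D z t (toLp T ι p t)) (timeMeasure T) :=
    integrable_dual_apply (Lp.memLp _) (Lp.memLp _)
  rw [← neg_neg ⟪pointValue z 0, pointValue p 0⟫_ℝ, ← hib, ← sub_eq_add_neg, dualPairing_apply,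
    ← integral_sub hs hi, L2.inner_def]
  apply integral_congr_ae
  filter_upwards [h, coeFn_obs_sub D y, coeFn_obs D z, coeFn_stateOp D z] with t h1 h2 h3 h4
  rw [h2, h3, h4, ← h1, toLp_apply, add_apply]
  ring

theorem IsAdjoint.inner_obs_eq (hT : 0 < T) (hι : Function.Injective ι) (h : IsAdjoint D y p)
    (z : stateSpace T ι) : ⟪obs ι D y - D.yd, obs ι D z⟫_ℝ =
      dualPairing T V (stateOp ι D z) (toLp T ι p) + ⟪pointValue z 0, pointValue p 0⟫_ℝ :=
  inner_obs_eq_of_adjoint hT hι (h.1.mono fun t ht => ht (val z t)) h.2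

theorem IsRedAdjoint.inner_obs_eq (hT : 0 < T) (hι : Function.Injective ι) {r : ℕ}
    {v : Fin r → V} (h : IsRedAdjoint D v y p) (hz : IsReducedState (redSpace v) z) :
    ⟪obs ι D y - D.yd, obs ι D z⟫_ℝ =
      dualPairing T V (stateOp ι D z) (toLp T ι p) + ⟪pointValue z 0, pointValue p 0⟫_ℝ :=
  inner_obs_eq_of_adjoint hT hι (by
    filter_upwards [h.2.1, hz] with t h1 h2 using h1 _ h2) h.2.2

theorem pointValue_add_smul (hT : 0 < T) (hι : Function.Injective ι) (y z : stateSpace T ι)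
    (s : ℝ) : pointValue (y + s • z) 0 = pointValue y 0 + s • pointValue z 0 := by
  have h0 : (0 : ℝ) ∈ Icc 0 T := left_mem_Icc.2 hT.le
  rw [← trace_apply hT hι h0, map_add, map_smul, trace_apply, trace_apply]

variable [CompleteSpace U]

/-- The first-order optimality condition of the full problem. -/
theorem IsOptimal.smul_add_eq_zero (hT : 0 < T) (hι : Function.Injective ι)
    (h : IsOptimal D u y) (hp : IsAdjoint D y p) :
    D.β • u + (dualControl D).compLp (toLp T ι p) = 0 := by
  obtain ⟨η, hη, hc⟩ := D.A_coercive
  set w := D.β • u + (dualControl D).compLp (toLp T ι p) with hw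
  -- The variation of the control is the gradient `w` itself, and `z` is the resulting variation of
  -- the state. The derivative of the cost is then `‖w‖²`.
  obtain ⟨z, hz, hz0⟩ := exists_solution (ι := ι) hT hι D.A_memLp hη hc (controlOp D w)
  have hz' : stateOp ι D z = controlOp D w := by
    refine Lp.ext ?_
    filter_upwards [hz, coeFn_stateOp D z] with t h1 h2
    rw [h2, h1]
  have hvar := inner_obs_add_eq_zero D (y := y) (z := z) (u := u) (w := w) fun s => by
    refine h.2 _ _ ⟨?_, ?_⟩
    · filter_upwards [h.1.1, hz, coeFn_controlOp D w, coeFn_add_smul y.1.1 z.1.1 s,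
        coeFn_add_smul y.1.2 z.1.2 s, coeFn_add_smul u w s] with t h1 h2 h3 h4 h5 h6
      have h4' : val (y + s • z) t = val y t + s • val z t := h4
      have h5' : timeDeriv (y + s • z) t = timeDeriv y t + s • timeDeriv z t := h5
      rw [h4', h5', h6, map_add, map_add, map_smul, map_smul, ← h3, ← h1, ← h2]
      module
    · rw [pointValue_add_smul hT hι, hz0, smul_zero, add_zero, h.1.2]
  rw [hp.inner_obs_eq hT hι, hz', hz0, inner_zero_left, add_zero, dualPairing_controlOp,
    ← real_inner_smul_left, add_comm, ← inner_add_left, ← hw] at hvar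
  exact inner_self_eq_zero.1 hvar

/-- The first-order optimality condition of the reduced problem: although only variations in the
reduced control space are admissible, the full gradient vanishes. -/
theorem IsRedOptimal.smul_add_eq_zero (hT : 0 < T) (hι : Function.Injective ι) {r : ℕ}
    {v : Fin r → V} (h : IsRedOptimal D v u y) (hp : IsRedAdjoint D v y p) :
    D.β • u + (dualControl D).compLp (toLp T ι p) = 0 := by
  set w := D.β • u + (dualControl D).compLp (toLp T ι p) with hw
  -- The gradient takes values in `Uᵣ`, so it may be used as a variation.
  have hwm : ∀ᵐ t ∂timeMeasure T, w t ∈ redControlSpace D v := by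
    filter_upwards [h.1, hp.1, Lp.coeFn_add (D.β • u) ((dualControl D).compLp (toLp T ι p)),
      Lp.coeFn_smul D.β u, (dualControl D).coeFn_compLp (toLp T ι p)] with t h1 h2 h3 h4 h5
    rw [hw, h3, Pi.add_apply, h4, Pi.smul_apply, h5]
    exact Submodule.add_mem _ (Submodule.smul_mem _ _ h1) (dualControl_mem D v h2)
  obtain ⟨z, hzr, hz, hz0⟩ := exists_reduced_solution hT hι D (redSpace v) (controlOp D w)
  have hz' : ∀ᵐ t ∂timeMeasure T, ∀ x ∈ redSpace v,
      timeDeriv z t x + D.A t (val z t) x = D.B (w t) x := by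
    filter_upwards [hz, coeFn_controlOp D w] with t h1 h2 x hx
    rw [h1 x hx, h2]
  have hvar := inner_obs_add_eq_zero D (y := y) (z := z) (u := u) (w := w) fun s => by
    refine h.2.2 _ _ ?_ ⟨?_, ?_, ?_⟩
    · filter_upwards [h.1, hwm, coeFn_add_smul u w s] with t h1 h2 h3
      rw [h3]
      exact Submodule.add_mem _ h1 (Submodule.smul_mem _ _ h2)
    · filter_upwards [h.2.1.1, hzr, coeFn_add_smul y.1.1 z.1.1 s] with t h1 h2 h3
      have h3' : val (y + s • z) t = val y t + s • val z t := h3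
      rw [h3']
      exact Submodule.add_mem _ h1 (Submodule.smul_mem _ _ h2)
    · filter_upwards [h.2.1.2.1, hz', coeFn_add_smul y.1.1 z.1.1 s,
        coeFn_add_smul y.1.2 z.1.2 s, coeFn_add_smul u w s] with t h1 h2 h4 h5 h6 x hx
      have h4' : val (y + s • z) t = val y t + s • val z t := h4
      have h5' : timeDeriv (y + s • z) t = timeDeriv y t + s • timeDeriv z t := h5
      rw [h4', h5', h6]
      simp only [map_add, map_smul, add_apply, smul_apply, smul_eq_mul]
      rw [← h1 x hx, ← h2 x hx]
      ring
    · rw [pointValue_add_smul hT hι, hz0, smul_zero, add_zero, h.2.1.2.2]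
  rw [hp.inner_obs_eq hT hι hzr, dualPairing_stateOp_eq D hp.1 hz', hz0, inner_zero_left, add_zero,
    dualPairing_controlOp, ← real_inner_smul_left, add_comm, ← inner_add_left, ← hw] at hvar
  exact inner_self_eq_zero.1 hvar

end Optimality

/-! ### Partial derivatives of the Lagrangian. -/

section Derivatives

variable {V H U : Type*}
  [NormedAddCommGroup V] [InnerProductSpace ℝ V] [CompleteSpace V]
  [NormedAddCommGroup H] [InnerProductSpace ℝ H] [CompleteSpace H]
  [NormedAddCommGroup U] [InnerProductSpace ℝ U]
  {T : ℝ} {ι : V →L[ℝ] H} (D : Data T V H U)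

/-- In `y` the Lagrangian is a squared norm plus an affine function; the initial-value term is
continuous because the trace is. -/
theorem exists_hasFDerivAt_lagrangian_left (hT : 0 < T) (hι : Function.Injective ι)
    (y : stateSpace T ι) (u : Lp U 2 (timeMeasure T)) (p : stateSpace T ι) :
    ∃ L : stateSpace T ι →L[ℝ] ℝ, HasFDerivAt (fun z => lagrangian D z u p) L y ∧
      ∀ z, L z = ⟪obs ι D y - D.yd, obs ι D z⟫_ℝ -
        dualPairing T V (stateOp ι D z) (toLp T ι p) - ⟪pointValue z 0, pointValue p 0⟫_ℝ := by
  have h0 : (0 : ℝ) ∈ Icc 0 T := left_mem_Icc.2 hT.le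
  let S : stateSpace T ι →L[ℝ] ℝ := ((dualPairing T V).flip (toLp T ι p)).comp (stateOp ι D)
  let R : stateSpace T ι →L[ℝ] ℝ := (innerSL ℝ (pointValue p 0)).comp (trace hT hι h0)
  have hobs : HasFDerivAt (fun z => obs ι D z - D.yd) (obs ι D) y :=
    (obs ι D).hasFDerivAt.sub_const _
  have h1 := (((hobs.norm_sq.const_mul (1 / 2)).sub S.hasFDerivAt).sub R.hasFDerivAt).add_const
    (D.β / 2 * ‖u‖ ^ 2 + dualPairing T V (controlOp D u) (toLp T ι p) +
      ⟪D.y0, pointValue p 0⟫_ℝ)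
  refine ⟨_, h1.congr_of_eventuallyEq (.of_forall fun z => ?_), fun z => ?_⟩
  · simp only [lagrangian_eq, map_sub, sub_apply, inner_sub_left, Pi.sub_apply]
    have hS : S z = dualPairing T V (stateOp ι D z) (toLp T ι p) := rfl
    have hR : R z = ⟪pointValue z 0, pointValue p 0⟫_ℝ := real_inner_comm _ _
    rw [hS, hR]
    ring
  · have hS : S z = dualPairing T V (stateOp ι D z) (toLp T ι p) := rfl
    have hR : R z = ⟪pointValue z 0, pointValue p 0⟫_ℝ := real_inner_comm _ _
    simp [hS, hR, inner_sub_left]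

theorem exists_hasFDerivAt_lagrangian_right (hT : 0 < T) (hι : Function.Injective ι)
    (y : stateSpace T ι) (u : Lp U 2 (timeMeasure T)) (p : stateSpace T ι) :
    ∃ L : stateSpace T ι →L[ℝ] ℝ, HasFDerivAt (fun q => lagrangian D y u q) L p ∧
      ∀ q, L q = dualPairing T V (controlOp D u) (toLp T ι q) -
        dualPairing T V (stateOp ι D y) (toLp T ι q) +
        ⟪D.y0 - pointValue y 0, pointValue q 0⟫_ℝ := by
  have h0 : (0 : ℝ) ∈ Icc 0 T := left_mem_Icc.2 hT.le
  let S : stateSpace T ι →L[ℝ] ℝ :=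
    (dualPairing T V (controlOp D u - stateOp ι D y)).comp (toLp T ι)
  let R : stateSpace T ι →L[ℝ] ℝ := (innerSL ℝ (D.y0 - pointValue y 0)).comp (trace hT hι h0)
  have hS : ∀ q, S q = dualPairing T V (controlOp D u - stateOp ι D y) (toLp T ι q) :=
    fun _ => rfl
  have hR : ∀ q, R q = ⟪D.y0 - pointValue y 0, pointValue q 0⟫_ℝ := fun _ => rfl
  have h1 := (S + R).hasFDerivAt (x := p) |>.add_const
    (1 / 2 * ‖obs ι D y - D.yd‖ ^ 2 + D.β / 2 * ‖u‖ ^ 2)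
  refine ⟨S + R, h1.congr_of_eventuallyEq (.of_forall fun q => ?_), fun q => ?_⟩
  · simp only [lagrangian_eq, add_apply, hS, hR]
    ring
  · rw [add_apply, hS, hR, map_sub, sub_apply]

theorem IsReducedState.pointValue_mem (hT : 0 < T) (hι : Function.Injective ι) {r : ℕ}
    {v : Fin r → V} {q : stateSpace T ι} (hq : IsReducedState (redSpace v) q) :
    pointValue q 0 ∈ redSpaceH ι v := by
  have h := map_pointValue_eq_zero hT hι (y := q)
    (ContinuousLinearMap.id ℝ H - (redSpaceH ι v).starProjection) (by
      filter_upwards [hq] with t ht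
      have : ι (val q t) ∈ redSpaceH ι v := ⟨_, ht, rfl⟩
      simp [Submodule.starProjection_eq_self_iff.2 this]) (left_mem_Icc.2 hT.le)
  rw [← Submodule.starProjection_eq_self_iff]
  exact (sub_eq_zero.1 h).symm

/-- The residual of the orthogonal projection is orthogonal to `Vᵣ`, which contains `q(0)` by
continuity and closedness. -/
theorem IsRedState.inner_sub_pointValue (hT : 0 < T) (hι : Function.Injective ι) {r : ℕ}
    {v : Fin r → V} {u : Lp U 2 (timeMeasure T)} {y q : stateSpace T ι} {D : Data T V H U}
    (hy : IsRedState D v u y) (hq : IsReducedState (redSpace v) q) :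
    ⟪D.y0 - pointValue y 0, pointValue q 0⟫_ℝ = 0 := by
  rw [hy.2.2]
  exact Submodule.starProjection_inner_eq_zero _ _ (hq.pointValue_mem hT hι)

end Derivatives

/-! ### Algebraic identities for the two costs. -/

section Identities

variable {V H U : Type*}
  [NormedAddCommGroup V] [InnerProductSpace ℝ V]
  [NormedAddCommGroup H] [InnerProductSpace ℝ H]
  [NormedAddCommGroup U] [InnerProductSpace ℝ U]
  {T : ℝ} {ι : V →L[ℝ] H} {D : Data T V H U}

theorem dualPairing_controlOp_eq [CompleteSpace U] {u : Lp U 2 (timeMeasure T)}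
    {p : stateSpace T ι} (h : D.β • u + (dualControl D).compLp (toLp T ι p) = 0)
    (w : Lp U 2 (timeMeasure T)) :
    dualPairing T V (controlOp D w) (toLp T ι p) = -(D.β * ⟪u, w⟫_ℝ) := by
  rw [dualPairing_controlOp, eq_neg_of_add_eq_zero_right h, inner_neg_left, real_inner_smul_left]

/-- For `a = C ȳ`, `b = C ȳʳ`, `d = y_d`, three of these products are evaluated by an adjoint
equation; the product `⟪b - d, a⟫` is the tracking part of `L'_y` in direction `ȳ`. -/
theorem tracking_identity {E : Type*} [NormedAddCommGroup E] [InnerProductSpace ℝ E] (a b d : E) :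
    ‖a - d‖ ^ 2 - ‖b - d‖ ^ 2 = ⟪a - d, a⟫_ℝ - ⟪b - d, b⟫_ℝ + ⟪b - d, a⟫_ℝ - ⟪a - d, b⟫_ℝ := by
  simp only [norm_sub_sq_real, inner_sub_left, real_inner_self_eq_norm_sq, real_inner_comm a d,
    real_inner_comm b d, real_inner_comm a b]
  ring

end Identities

/-! ### Galerkin orthogonality and the error representation. -/

section ErrorRepresentation

variable {V H U : Type*}
  [NormedAddCommGroup V] [InnerProductSpace ℝ V] [CompleteSpace V]
  [NormedAddCommGroup H] [InnerProductSpace ℝ H] [CompleteSpace H]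
  [NormedAddCommGroup U] [InnerProductSpace ℝ U]
  {T : ℝ} {ι : V →L[ℝ] H} {D : Data T V H U}

theorem lagrangianDerivY_apply (hT : 0 < T) (hι : Function.Injective ι)
    (y : stateSpace T ι) (u : Lp U 2 (timeMeasure T)) (p z : stateSpace T ι) :
    lagrangianDerivY D y u p z = ⟪obs ι D y - D.yd, obs ι D z⟫_ℝ -
      dualPairing T V (stateOp ι D z) (toLp T ι p) - ⟪pointValue z 0, pointValue p 0⟫_ℝ := by
  obtain ⟨L, hL, hL'⟩ := exists_hasFDerivAt_lagrangian_left D hT hι y u p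
  rw [lagrangianDerivY, hL.fderiv, hL']

theorem lagrangianDerivP_apply (hT : 0 < T) (hι : Function.Injective ι)
    (y : stateSpace T ι) (u : Lp U 2 (timeMeasure T)) (p q : stateSpace T ι) :
    lagrangianDerivP D y u p q = dualPairing T V (controlOp D u) (toLp T ι q) -
      dualPairing T V (stateOp ι D y) (toLp T ι q) +
      ⟪D.y0 - pointValue y 0, pointValue q 0⟫_ℝ := by
  obtain ⟨L, hL, hL'⟩ := exists_hasFDerivAt_lagrangian_right D hT hι y u p
  rw [lagrangianDerivP, hL.fderiv, hL']

variable {r : ℕ} {v : Fin r → V} {yr pr : stateSpace T ι} {ur : Lp U 2 (timeMeasure T)}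

/-- By Galerkin orthogonality the error terms do not depend on the reduced test functions. -/
theorem errorTerms_eq_singleton (hT : 0 < T) (hι : Function.Injective ι)
    (hyr : IsRedState D v ur yr) (hpr : IsRedAdjoint D v yr pr) (y p : stateSpace T ι) :
    errorTerms D v yr ur pr y p =
      {lagrangianDerivY D yr ur pr y + lagrangianDerivP D yr ur pr p} := by
  have hY : ∀ z, IsReducedState (redSpace v) z → lagrangianDerivY D yr ur pr z = 0 := by
    intro z hz
    rw [lagrangianDerivY_apply hT hι, hpr.inner_obs_eq hT hι hz]
    ring
  have hP : ∀ q, IsReducedState (redSpace v) q → lagrangianDerivP D yr ur pr q = 0 := by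
    intro q hq
    rw [lagrangianDerivP_apply hT hι, dualPairing_stateOp_eq D hq hyr.2.1,
      hyr.inner_sub_pointValue hT hι hq]
    ring
  apply Subset.antisymm
  · rintro s ⟨z, q, hz, hq, hs⟩
    rw [map_sub, map_sub, hY z hz, hP q hq, sub_zero, sub_zero] at hs
    exact hs
  · rintro s hs
    refine ⟨yr, pr, hyr.1, hpr.1, ?_⟩
    rw [map_sub, map_sub, hY _ hyr.1, hP _ hpr.1, sub_zero, sub_zero]
    exact hs

/-- The gradient conditions turn the pairings with `B` into inner products of controls. The squares
`β ‖u‖²` and `β ‖ur‖²` cancel against the control cost, and the mixed term `β ⟪ur, u⟫` enters `L'_y`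
and `L'_p` with opposite signs. -/
theorem cost_sub_cost_eq [CompleteSpace U] (hT : 0 < T) (hι : Function.Injective ι)
    {u : Lp U 2 (timeMeasure T)} {y p : stateSpace T ι}
    (hu : IsOptimal D u y) (hp : IsAdjoint D y p)
    (hur : IsRedOptimal D v ur yr) (hpr : IsRedAdjoint D v yr pr) :
    cost D y u - cost D yr ur =
      1 / 2 * (lagrangianDerivY D yr ur pr y + lagrangianDerivP D yr ur pr p) := by
  rw [lagrangianDerivY_apply hT hι, lagrangianDerivP_apply hT hι, cost_eq, cost_eq]
  have g : ∀ w, dualPairing T V (controlOp D w) (toLp T ι p) = -(D.β * ⟪u, w⟫_ℝ) :=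
    dualPairing_controlOp_eq (hu.smul_add_eq_zero hT hι hp)
  have gr : ∀ w, dualPairing T V (controlOp D w) (toLp T ι pr) = -(D.β * ⟪ur, w⟫_ℝ) :=
    dualPairing_controlOp_eq (hur.smul_add_eq_zero hT hι hpr)
  have e1 : dualPairing T V (stateOp ι D y) (toLp T ι p) = -(D.β * ‖u‖ ^ 2) := by
    rw [hu.1.stateOp_eq, ← real_inner_self_eq_norm_sq u]
    exact g u
  have e2 : dualPairing T V (stateOp ι D y) (toLp T ι pr) = -(D.β * ⟪ur, u⟫_ℝ) := by
    rw [hu.1.stateOp_eq]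
    exact gr u
  have e3 : dualPairing T V (controlOp D ur) (toLp T ι p) = -(D.β * ⟪ur, u⟫_ℝ) := by
    rw [real_inner_comm u ur]
    exact g ur
  -- The reduced state equation holds only against functions with values in `Vᵣ`, so it applies to
  -- `pr`; the pairing with `p` is left as it is and is part of `L'_p`.
  have e4 : dualPairing T V (stateOp ι D yr) (toLp T ι pr) = -(D.β * ‖ur‖ ^ 2) := by
    rw [dualPairing_stateOp_eq D hpr.1 hur.2.1.2.1, ← real_inner_self_eq_norm_sq ur]
    exact gr ur
  have i1 : ⟪pointValue y 0, pointValue p 0⟫_ℝ = ⟪D.y0, pointValue p 0⟫_ℝ :=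
    congrArg (fun x => ⟪x, pointValue p 0⟫_ℝ) hu.1.2
  have i2 : ⟪pointValue y 0, pointValue pr 0⟫_ℝ = ⟪D.y0, pointValue pr 0⟫_ℝ :=
    congrArg (fun x => ⟪x, pointValue pr 0⟫_ℝ) hu.1.2
  have i3 : ⟪D.y0, pointValue pr 0⟫_ℝ - ⟪pointValue yr 0, pointValue pr 0⟫_ℝ = 0 :=
    (inner_sub_left _ _ _).symm.trans (hur.2.1.inner_sub_pointValue hT hι hpr.1)
  have i4 := inner_sub_left (𝕜 := ℝ) D.y0 (pointValue yr 0) (pointValue p 0)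
  have a1 := hp.inner_obs_eq hT hι y
  have a2 := hp.inner_obs_eq hT hι yr
  have a3 := hpr.inner_obs_eq hT hι hur.2.1.1
  have key := tracking_identity (obs ι D y) (obs ι D yr) D.yd
  linarith

end ErrorRepresentation

end ParabolicOCP

end

theorem mainTheorem3 {V H U : Type*}
    [NormedAddCommGroup V] [InnerProductSpace ℝ V] [CompleteSpace V]
    [TopologicalSpace.SeparableSpace V]
    [NormedAddCommGroup H] [InnerProductSpace ℝ H] [CompleteSpace H]
    [TopologicalSpace.SeparableSpace H]
    [NormedAddCommGroup U] [InnerProductSpace ℝ U] [CompleteSpace U]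
    [TopologicalSpace.SeparableSpace U]
    (T : ℝ) (hT : 0 < T)
    (ι : V →L[ℝ] H) (hι_inj : Function.Injective ι) (hι_dense : DenseRange ι)
    (hι_compact : IsCompactOperator ι)
    (D : ParabolicOCP.Data T V H U)
    (r : ℕ) (v : Fin r → V)
    (u : Lp U 2 (ParabolicOCP.timeMeasure T)) (y p : ParabolicOCP.stateSpace T ι)
    (hu : ParabolicOCP.IsOptimal D u y) (hp : ParabolicOCP.IsAdjoint D y p)
    (ur : Lp U 2 (ParabolicOCP.timeMeasure T)) (yr pr : ParabolicOCP.stateSpace T ι)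
    (hur : ParabolicOCP.IsRedOptimal D v ur yr) (hpr : ParabolicOCP.IsRedAdjoint D v yr pr) :
    DifferentiableAt ℝ (fun z => ParabolicOCP.lagrangian D z ur pr) yr ∧
    DifferentiableAt ℝ (fun q => ParabolicOCP.lagrangian D yr ur q) pr ∧
    (ParabolicOCP.errorTerms D v yr ur pr y p).Nonempty ∧
    BddBelow (ParabolicOCP.errorTerms D v yr ur pr y p) ∧
    ParabolicOCP.cost D y u - ParabolicOCP.cost D yr ur
      = 1 / 2 * sInf (ParabolicOCP.errorTerms D v yr ur pr y p) := by
  obtain ⟨_, hLy, -⟩ :=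
    ParabolicOCP.exists_hasFDerivAt_lagrangian_left D hT hι_inj yr ur pr
  obtain ⟨_, hLp, -⟩ :=
    ParabolicOCP.exists_hasFDerivAt_lagrangian_right D hT hι_inj yr ur pr
  have hset := ParabolicOCP.errorTerms_eq_singleton hT hι_inj hur.2.1 hpr y p
  refine ⟨hLy.differentiableAt, hLp.differentiableAt, ?_, ?_, ?_⟩
  · rw [hset]
    exact singleton_nonempty _
  · rw [hset]
    exact bddBelow_singleton
  · rw [hset, csInf_singleton, ParabolicOCP.cost_sub_cost_eq hT hι_inj hu hp hur hpr]
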